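/- **Setting.** Let $W_i=(D_i,Y_i,X_i)$, $i\ge 1$, be i.i.d. with $D_i\in\{0,1\}$, $Y_i$ real and integrable, and $X_i$ a random vector of covariates. Write $\mu_d(x)=\mathbb E[Y_i\mid D_i=d,X_i=x]$, $\sigma_d^2(x)=\mathrm{Var}[Y_i\mid D_i=d,X_i=x]$, $p(x)=P(D_i=1\mid X_i=x)$, $\theta=\mathbb E[\mu_1(X_i)-\mu_0(X_i)]$, and $\|g\|_s=\mathbb E[|g(X_i)|^s]^{1/s}$. **Estimator.** Fix $K$ and $J$. For each $N$ partition $\{1,\dots,N\}$ into $K$ folds $I^{(k)}$ and each fold into $J$ sub-folds $I^{(k,j)}$. For each $k$ fit $\hat\mu_0,\hat\mu_1,\hat p$ on the observations outside $I^{(k)}$. For each $j$ fit a calibrator $\tilde f=\tilde f_{\hat p}:\mathbb R\to\mathbb R$ on the scores $\hat p(X_i)$ and the observations with $i\in I^{(k)}\setminus I^{(k,j)}$, and put $\tilde\pi=\tilde f\circ\hat p$. For $i\in I^{(k,j)}$ let $$\tau_i=\hat\mu_1(X_i)-\hat\mu_0(X_i)+\frac{D_i(Y_i-\hat\mu_1(X_i))}{\tilde\pi(X_i)}-\frac{(1-D_i)(Y_i-\hat\mu_0(X_i))}{1-\tilde\pi(X_i)},\qquad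 \hat\theta=\frac1N\sum_{i=1}^N\tau_i .$$ For a fixed score function $q$, $\tilde f_q$ denotes the same calibrator computed with $q$ in place of $\hat p$. **Assumption 1.** There are sets $\Xi_{\mu_d,N}\ni\mu_d$ and $\Xi_{p,N}\ni p$ of measurable functions such that, with $r_{\mu_d,N}=\sup_{m\in\Xi_{\mu_d,N}}\|m-\mu_d\|_2$ and $r_{p,N}=\sup_{q\in\Xi_{p,N}}\|q-p\|_2$: (i) $\mathrm{Var}[\mu_1(X_i)-\mu_0(X_i)]<\infty$ and $\mathbb E[(Y_i-\mu_{D_i}(X_i))^2]<\infty$; (ii) for some $\epsilon>0$, almost surely $\epsilon\le p(X)\le1-\epsilon$ and $\epsilon\le\hat p(X)\le 1-\epsilon$, for a copy $X$ of $X_i$ independent of the sample; (iii) for each fold, $\hat\mu_d\in\Xi_{\mu_d,N}$ ($d=0,1$) and $\hat p\in\Xi_{p,N}$ with probability $1-o(1)$; (iv) for some $w>2$ and every $N$, $\sup_{m\in\Xi_{\mu_d,N}}\|m-\mu_d\|_w<\infty$ and $\sup_{q\in\Xi_{p,N}}\|q-p\|_w<\infty$; (v) $r_{\mu_d,N}=o(1)$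 and $r_{p,N}=o(1)$; (vi) $r_{\mu_d,N}\,r_{p,N}=o(N^{-1/2})$. **Assumption 2.** For $q\in\Xi_{p,N}$ let $f_q(q(X_i))=\mathbb E[D_i\mid q(X_i)]$ (so $f_p$ is the identity on the values of $p(X_i)$, almost surely), let $\Lambda_{N,q}\ni f_q$ be a set of measurable functions, and let $r_{f,N}=\sup_{q\in\Xi_{p,N}}\sup_{g\in\Lambda_{N,q}}\|g\circ q-f_q\circ q\|_2$. Then: (i) for each sub-fold there is $\delta_N\to0$ with $P(\tilde f_q\in\Lambda_{N,q})\ge1-\delta_N$ for all $q\in\Xi_{p,N}$; (ii) for all $q\in\Xi_{p,N}$, almost surely $\epsilon\le\tilde f_q(q(X))\le1-\epsilon$; (iii) $r_{f,N}=o(1)$; (iv) $r_{\mu_d,N}\,r_{f,N}=o(N^{-1/2})$; (v) $\sup_{q\in\Xi_{p,N}}\|f_q\circ q-p\|_2\le C\,\sup_{q\in\Xi_{p,N}}\|q-p\|_2$ for a fixed $C>0$. **Theorem.** Under Assumptions 1 and 2, $$\sqrt N(\hat\theta-\theta)\xrightarrow{d}\mathcal N(0,V),\qquad V=\mathrm{Var}[\mu_1(X_i)-\mu_0(X_i)]+\mathbb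 E\Big[\frac{\sigma_1^2(X_i)}{p(X_i)}\Big]+\mathbb E\Big[\frac{\sigma_0^2(X_i)}{1-p(X_i)}\Big].$$ -/

import Mathlib

open MeasureTheory ProbabilityTheory Filter Topology
open scoped ENNReal NNReal

noncomputable section

namespace CalDML

/-- An observation `(D, Y, X)`: binary treatment, real outcome, covariates. -/
abbrev Obs (𝓧 : Type*) := Fin 2 × ℝ × 𝓧

/-- The treatment arm of an observation. -/
def arm {𝓧 : Type*} (w : Obs 𝓧) : Fin 2 := w.1

/-- The treatment of an observation as a real number, `0` or `1`. -/
def treat {𝓧 : Type*} (w : Obs 𝓧) : ℝ := ((w.1 : ℕ) : ℝ)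

/-- The outcome of an observation. -/
def outcome {𝓧 : Type*} (w : Obs 𝓧) : ℝ := w.2.1

/-- The covariates of an observation. -/
def cov {𝓧 : Type*} (w : Obs 𝓧) : 𝓧 := w.2.2

/-- `μ d x = E[Y | D = d, X = x]`, `σ2 d x = Var[Y | D = d, X = x]` and `p x = P(D = 1 | X = x)`
under the law `Q` of one observation (versions of the conditional expectations). -/
structure IsNuisance {𝓧 : Type*} [MeasurableSpace 𝓧] (Q : Measure (Obs 𝓧))
    (μ σ2 : Fin 2 → 𝓧 → ℝ) (p : 𝓧 → ℝ) : Prop where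
  measurable_mean : ∀ d, Measurable (μ d)
  measurable_variance : ∀ d, Measurable (σ2 d)
  measurable_propensity : Measurable p
  mean : Q[outcome | MeasurableSpace.comap (fun w => (arm w, cov w)) inferInstance]
    =ᵐ[Q] fun w => μ (arm w) (cov w)
  variance : Var[outcome; Q | MeasurableSpace.comap (fun w => (arm w, cov w)) inferInstance]
    =ᵐ[Q] fun w => σ2 (arm w) (cov w)
  propensity : Q[treat | MeasurableSpace.comap cov inferInstance] =ᵐ[Q] fun w => p (cov w)

/-- The target parameter `θ = E[μ(1, X) - μ(0, X)]`. -/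
def target {𝓧 : Type*} [MeasurableSpace 𝓧] (Q : Measure (Obs 𝓧)) (μ : Fin 2 → 𝓧 → ℝ) : ℝ :=
  ∫ w, (μ 1 (cov w) - μ 0 (cov w)) ∂Q

/-- `V = Var[μ₁(X) - μ₀(X)] + E[σ₁²(X) / p(X)] + E[σ₀²(X) / (1 - p(X))]`. -/
def asympVar {𝓧 : Type*} [MeasurableSpace 𝓧] (Q : Measure (Obs 𝓧))
    (μ σ2 : Fin 2 → 𝓧 → ℝ) (p : 𝓧 → ℝ) : ℝ :=
  Var[fun w => μ 1 (cov w) - μ 0 (cov w); Q]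
    + ∫ w, σ2 1 (cov w) / p (cov w) ∂Q
    + ∫ w, σ2 0 (cov w) / (1 - p (cov w)) ∂Q

/-- The score `τ` with outcome regressions `m` and propensity score `π`. -/
def score {𝓧 : Type*} (m : Fin 2 → 𝓧 → ℝ) (π : 𝓧 → ℝ) (w : Obs 𝓧) : ℝ :=
  m 1 (cov w) - m 0 (cov w)
    + treat w * (outcome w - m 1 (cov w)) / π (cov w)
    - (1 - treat w) * (outcome w - m 0 (cov w)) / (1 - π (cov w))

/-- The norm `‖g(X)‖_s` under the law `Q` of one observation. -/
def normX {𝓧 : Type*} [MeasurableSpace 𝓧] (Q : Measure (Obs 𝓧)) (s : ℝ≥0∞) (g : 𝓧 → ℝ) :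
    ℝ≥0∞ :=
  eLpNorm (fun w => g (cov w)) s Q

/-- The worst `‖g*(X) - g(X)‖_s` over `g*` in the class `G`. -/
def supDist {𝓧 : Type*} [MeasurableSpace 𝓧] (Q : Measure (Obs 𝓧)) (s : ℝ≥0∞)
    (G : Set (𝓧 → ℝ)) (g : 𝓧 → ℝ) : ℝ≥0∞ :=
  ⨆ g' ∈ G, normX Q s (fun x => g' x - g x)

/-- The specification of a calibrated cross-fitted procedure with `K` folds, each of them split
into `J` sub-folds: for every sample size `N`, the partition of the indices, the outcome
regression and propensity score learners (fitted on the complement of the fold `k`), and the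
calibrator (fitted on the scores and observations of the fold `k` outside its sub-fold `j`). -/
structure Procedure (𝓧 : Type*) (K J : ℕ) where
  fold : ∀ N : ℕ, Fin N → Fin K × Fin J
  muHat : ∀ (N : ℕ) (k : Fin K), Fin 2 → ({i : Fin N // (fold N i).1 ≠ k} → Obs 𝓧) → 𝓧 → ℝ
  pHat : ∀ (N : ℕ) (k : Fin K), ({i : Fin N // (fold N i).1 ≠ k} → Obs 𝓧) → 𝓧 → ℝ
  fTilde : ∀ (N : ℕ) (k : Fin K) (j : Fin J),
    ({i : Fin N // (fold N i).1 = k ∧ (fold N i).2 ≠ j} → ℝ × Obs 𝓧) → ℝ → ℝ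

namespace Procedure

variable {𝓧 Ω : Type*} {K J : ℕ}

/-- Joint measurability of the learners and of the calibrator in the data and the argument. -/
structure IsMeasurable [MeasurableSpace 𝓧] (A : Procedure 𝓧 K J) : Prop where
  muHat : ∀ N k d, Measurable (Function.uncurry (A.muHat N k d))
  pHat : ∀ N k, Measurable (Function.uncurry (A.pHat N k))
  fTilde : ∀ N k j, Measurable (Function.uncurry (A.fTilde N k j))

/-- The training sample for the fold `k`. -/
def train (A : Procedure 𝓧 K J) (W : ℕ → Ω → Obs 𝓧) (N : ℕ) (k : Fin K) (ω : Ω) :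
    {i : Fin N // (A.fold N i).1 ≠ k} → Obs 𝓧 :=
  fun i => W (i : Fin N) ω

/-- The outcome regressions fitted for the fold `k`. -/
def muFit (A : Procedure 𝓧 K J) (W : ℕ → Ω → Obs 𝓧) (N : ℕ) (k : Fin K) (ω : Ω) :
    Fin 2 → 𝓧 → ℝ :=
  fun d => A.muHat N k d (A.train W N k ω)

/-- The uncalibrated propensity score fitted for the fold `k`. -/
def pFit (A : Procedure 𝓧 K J) (W : ℕ → Ω → Obs 𝓧) (N : ℕ) (k : Fin K) (ω : Ω) : 𝓧 → ℝ :=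
  A.pHat N k (A.train W N k ω)

/-- The calibrator for the score function `q`, fitted on the fold `k` without its sub-fold `j`. -/
def calFit (A : Procedure 𝓧 K J) (W : ℕ → Ω → Obs 𝓧) (N : ℕ) (k : Fin K) (j : Fin J)
    (q : 𝓧 → ℝ) (ω : Ω) : ℝ → ℝ :=
  A.fTilde N k j (fun i => (q (cov (W (i : Fin N) ω)), W (i : Fin N) ω))

/-- The calibrated propensity score `f̃ ∘ p̂` used on the sub-fold `(k, j)`. -/
def piFit (A : Procedure 𝓧 K J) (W : ℕ → Ω → Obs 𝓧) (N : ℕ) (k : Fin K) (j : Fin J) (ω : Ω) :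
    𝓧 → ℝ :=
  fun x => A.calFit W N k j (A.pFit W N k ω) ω (A.pFit W N k ω x)

/-- The calibrated cross-fitted estimator of `θ`: the mean of the pseudo-outcomes. -/
def thetaHat (A : Procedure 𝓧 K J) (W : ℕ → Ω → Obs 𝓧) (N : ℕ) (ω : Ω) : ℝ :=
  (1 / (N : ℝ)) * ∑ i : Fin N,
    score (A.muFit W N (A.fold N i).1 ω) (A.piFit W N (A.fold N i).1 (A.fold N i).2 ω) (W i ω)

end Procedure

/-- The conditions on the law of the data and on the uncalibrated nuisance estimators.
`Ξμ N d` and `Ξp N` are the realization sets for `μ_d` and `p`. -/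
structure DMLConditions {𝓧 Ω : Type*} [MeasurableSpace 𝓧] [MeasurableSpace Ω] {K J : ℕ}
    (P : Measure Ω) (W : ℕ → Ω → Obs 𝓧) (Q : Measure (Obs 𝓧))
    (μ : Fin 2 → 𝓧 → ℝ) (p : 𝓧 → ℝ) (A : Procedure 𝓧 K J)
    (Ξμ : ℕ → Fin 2 → Set (𝓧 → ℝ)) (Ξp : ℕ → Set (𝓧 → ℝ)) (ε w : ℝ) : Prop where
  mean_mem : ∀ N d, μ d ∈ Ξμ N d
  propensity_mem : ∀ N, p ∈ Ξp N
  measurable_mean : ∀ N d, ∀ m ∈ Ξμ N d, Measurable m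
  measurable_propensity : ∀ N, ∀ q ∈ Ξp N, Measurable q
  integrable_outcome : Integrable outcome Q
  finite_effect_variance : MemLp (fun v => μ 1 (cov v) - μ 0 (cov v)) 2 Q
  finite_residual_variance : MemLp (fun v => outcome v - μ (arm v) (cov v)) 2 Q
  overlap : ∀ᵐ v ∂Q, ε ≤ p (cov v) ∧ p (cov v) ≤ 1 - ε
  overlap_hat : ∀ N k, ∀ᵐ ω ∂P, ∀ᵐ v ∂Q,
    ε ≤ A.pFit W N k ω (cov v) ∧ A.pFit W N k ω (cov v) ≤ 1 - ε
  realization : ∀ k, Tendsto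
    (fun N => P {ω | ¬ ((∀ d, A.muFit W N k ω d ∈ Ξμ N d) ∧ A.pFit W N k ω ∈ Ξp N)})
    atTop (𝓝 0)
  moment_mean : ∀ N d, supDist Q (ENNReal.ofReal w) (Ξμ N d) (μ d) < ∞
  moment_propensity : ∀ N, supDist Q (ENNReal.ofReal w) (Ξp N) p < ∞
  rate_mean : ∀ d, Tendsto (fun N => supDist Q 2 (Ξμ N d) (μ d)) atTop (𝓝 0)
  rate_propensity : Tendsto (fun N => supDist Q 2 (Ξp N) p) atTop (𝓝 0)
  rate_product : ∀ d, Tendsto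
    (fun N : ℕ => ENNReal.ofReal (√(N : ℝ)) *
      (supDist Q 2 (Ξμ N d) (μ d) * supDist Q 2 (Ξp N) p)) atTop (𝓝 0)

/-- The rate of the calibrator, `sup_{q ∈ Ξ} sup_{g ∈ Λ q} ‖g(q(X)) - f_q(q(X))‖₂`. -/
def calRate {𝓧 : Type*} [MeasurableSpace 𝓧] (Q : Measure (Obs 𝓧)) (f : (𝓧 → ℝ) → ℝ → ℝ)
    (Ξ : Set (𝓧 → ℝ)) (Λ : (𝓧 → ℝ) → Set (ℝ → ℝ)) : ℝ≥0∞ :=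
  ⨆ q ∈ Ξ, ⨆ g ∈ Λ q, normX Q 2 (fun x => g (q x) - f q (q x))

/-- The conditions on the calibrator. `f q` is the calibration function of the score function
`q`, that is `f q (q(X)) = E[D | q(X)]`, and `Λ N q` is the realization set for `f q`. -/
structure CalibratorConditions {𝓧 Ω : Type*} [MeasurableSpace 𝓧] [MeasurableSpace Ω] {K J : ℕ}
    (P : Measure Ω) (W : ℕ → Ω → Obs 𝓧) (Q : Measure (Obs 𝓧))
    (μ : Fin 2 → 𝓧 → ℝ) (p : 𝓧 → ℝ) (A : Procedure 𝓧 K J)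
    (Ξμ : ℕ → Fin 2 → Set (𝓧 → ℝ)) (Ξp : ℕ → Set (𝓧 → ℝ))
    (f : (𝓧 → ℝ) → ℝ → ℝ) (Λ : ℕ → (𝓧 → ℝ) → Set (ℝ → ℝ)) (ε C : ℝ) : Prop where
  measurable_calibration : ∀ N, ∀ q ∈ Ξp N, Measurable (f q)
  calibration : ∀ N, ∀ q ∈ Ξp N,
    Q[treat | MeasurableSpace.comap (fun v => q (cov v)) inferInstance]
      =ᵐ[Q] fun v => f q (q (cov v))
  calibration_mem : ∀ N, ∀ q ∈ Ξp N, f q ∈ Λ N q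
  measurable_realization : ∀ N, ∀ q ∈ Ξp N, ∀ g ∈ Λ N q, Measurable g
  realization : ∀ k j, ∃ δ : ℕ → ℝ≥0∞, Tendsto δ atTop (𝓝 0) ∧
    ∀ N, ∀ q ∈ Ξp N, P {ω | A.calFit W N k j q ω ∉ Λ N q} ≤ δ N
  overlap : ∀ N k j, ∀ q ∈ Ξp N, ∀ᵐ ω ∂P, ∀ᵐ v ∂Q,
    ε ≤ A.calFit W N k j q ω (q (cov v)) ∧ A.calFit W N k j q ω (q (cov v)) ≤ 1 - ε
  rate : Tendsto (fun N => calRate Q f (Ξp N) (Λ N)) atTop (𝓝 0)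
  rate_product : ∀ d, Tendsto
    (fun N : ℕ => ENNReal.ofReal (√(N : ℝ)) *
      (supDist Q 2 (Ξμ N d) (μ d) * calRate Q f (Ξp N) (Λ N))) atTop (𝓝 0)
  error_bound : ∀ N, (⨆ q ∈ Ξp N, normX Q 2 (fun x => f q (q x) - p x))
    ≤ ENNReal.ofReal C * supDist Q 2 (Ξp N) p

end CalDML

end

/-! The estimator is asymptotically equivalent to the oracle average of `score μ p`, and the central
limit theorem gives the limit of the oracle. By `sqrt_mul_thetaHat_sub` the difference of the two,
scaled by `√N`, is a sum over the finitely many sub-folds of `cellError`, so it suffices that each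
of these tends to zero in probability.

For fixed nuisances the score is doubly robust. In each arm `armScore_sub_eq` splits its error
exactly into a part linear in the regression error, a part linear in the residual, and a product of
the two estimation errors. The first two parts have mean zero: the indicator of the arm divided by
its probability has conditional mean one given the covariates, and the residual has conditional mean
zero given the arm and the covariates. Their normalized sums are therefore controlled by their `L²`
norms, which need only be `o(1)`. The product has no centering and costs a factor `√N`, which the
product rates absorb after Cauchy-Schwarz.

The nuisances become fixed by conditioning twice, each time through `measure_mem_le_of_indepFun`.
The outer step freezes the regressions and the raw propensity by conditioning on the complement of
the fold (`eventually_measure_cellError_le`). The inner step freezes the calibrator by conditioning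
on the rest of the fold (`eventually_measure_normalizedSum_calFit_le`). The order matters: the
calibrator is controlled for deterministic score functions, uniformly over the realization set, so
the fitted score must be frozen first. The calibrated propensity then has `L²` error at most
`calibratedRate`.

The variance formula follows because the effect and the weighted residual are orthogonal
(`variance_score`). -/

namespace CalDML

/-! ### Conditioning through independence. -/

/-- If `T` and `U` are independent and the conditional probability of `(T, U) ∈ E` given `T` is at
most `c` outside an event of outer measure at most `δ`, then `(T, U) ∈ E` has probability at most
`c + δ`. -/
lemma measure_mem_le_of_indepFun {Ω α β : Type*} [MeasurableSpace Ω] [MeasurableSpace α]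
    [MeasurableSpace β] {P : Measure Ω} [IsProbabilityMeasure P] {T : Ω → α} {U : Ω → β}
    (hT : Measurable T) (hU : Measurable U) (hTU : IndepFun T U P) {E : Set (α × β)}
    (hE : MeasurableSet E) {c δ : ℝ≥0∞}
    (hbad : P {ω' | ¬ P {ω | (T ω', U ω) ∈ E} ≤ c} ≤ δ) :
    P {ω | (T ω, U ω) ∈ E} ≤ c + δ := by
  have := Measure.isProbabilityMeasure_map (μ := P) hT.aemeasurable
  have := Measure.isProbabilityMeasure_map (μ := P) hU.aemeasurable
  have hmeas : Measurable fun a => P.map U (Prod.mk a ⁻¹' E) := measurable_measure_prodMk_left hE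
  have hsec : ∀ ω', P.map U (Prod.mk (T ω') ⁻¹' E) = P {ω | (T ω', U ω) ∈ E} := fun ω' =>
    Measure.map_apply hU (measurable_prodMk_left hE)
  -- The bad event is measurable because the probabilities of sections are. The events that cover it
  -- in the applications, such as failure of membership in a realization set, need not be, so `hbad`
  -- is used with an outer measure bound.
  have hbadm : MeasurableSet {ω' | ¬ P {ω | (T ω', U ω) ∈ E} ≤ c} := by
    simp_rw [← hsec]
    exact (measurableSet_le (hmeas.comp hT) measurable_const).compl
  calc P {ω | (T ω, U ω) ∈ E} = P.map (fun ω => (T ω, U ω)) E :=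
        (Measure.map_apply (hT.prodMk hU) hE).symm
    _ = ((P.map T).prod (P.map U)) E := by
        rw [(indepFun_iff_map_prod_eq_prod_map_map hT.aemeasurable hU.aemeasurable).1 hTU]
    _ = ∫⁻ ω', P {ω | (T ω', U ω) ∈ E} ∂P := by
        rw [Measure.prod_apply hE, lintegral_map hmeas hT]
        simp_rw [hsec]
    _ ≤ ∫⁻ ω', (c + {ω' | ¬ P {ω | (T ω', U ω) ∈ E} ≤ c}.indicator 1 ω') ∂P := by
        refine lintegral_mono fun ω' => ?_
        by_cases h : P {ω | (T ω', U ω) ∈ E} ≤ c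
        · exact h.trans le_self_add
        · rw [Set.indicator_of_mem h]
          exact prob_le_one.trans le_add_self
    _ ≤ c + δ := by
        rw [lintegral_add_left measurable_const, lintegral_indicator_one hbadm]
        simp only [lintegral_const, measure_univ, mul_one]
        gcongr

/-- Subfamilies of an independent family over disjoint index sets are independent. -/
lemma indepFun_subtype {Ω α ι : Type*} [Fintype ι] [MeasurableSpace Ω] [MeasurableSpace α]
    {P : Measure Ω} {W : ι → Ω → α} (hW : ∀ i, Measurable (W i))
    (hindep : iIndepFun W P) {a b : ι → Prop} (hab : ∀ i, a i → ¬ b i) :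
    IndepFun (fun ω (i : {i // a i}) => W i ω) (fun ω (i : {i // b i}) => W i ω) P := by
  classical
  have h := hindep.indepFun_finset (Finset.univ.filter a) (Finset.univ.filter b)
    (Finset.disjoint_filter.2 fun i _ => hab i) hW
  exact h.comp
    (φ := fun x (i : {i // a i}) => x ⟨i.1, by simpa using i.2⟩)
    (ψ := fun x (i : {i // b i}) => x ⟨i.1, by simpa using i.2⟩)
    (measurable_pi_lambda _ fun i => measurable_pi_apply _)
    (measurable_pi_lambda _ fun i => measurable_pi_apply _)

lemma eLpNorm_two_eq_ofReal_sqrt {α : Type*} [MeasurableSpace α] {ν : Measure α} {g : α → ℝ}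
    (hg : MemLp g 2 ν) : eLpNorm g 2 ν = ENNReal.ofReal √(∫ x, g x ^ 2 ∂ν) := by
  rw [hg.eLpNorm_eq_integral_rpow_norm (by norm_num) (by norm_num)]
  simp [Real.sqrt_eq_rpow]

/-! ### `L¹` bounds for normalized sums of i.i.d. terms. -/

section NormalizedSum

variable {Ω α ι : Type*} {W : ι → Ω → α}

/-- The normalized partial sum `n^{-1/2} ∑_{i ∈ s} g (W i)`. -/
noncomputable def normalizedSum (W : ι → Ω → α) (n : ℕ) (s : Finset ι) (g : α → ℝ) (ω : Ω) : ℝ :=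
  (√(n : ℝ))⁻¹ * ∑ i ∈ s, g (W i ω)

lemma normalizedSum_add (n : ℕ) (s : Finset ι) (g h : α → ℝ) :
    normalizedSum W n s (g + h) = normalizedSum W n s g + normalizedSum W n s h := by
  ext ω
  simp [normalizedSum, Finset.sum_add_distrib, mul_add]

lemma normalizedSum_sub (n : ℕ) (s : Finset ι) (g h : α → ℝ) :
    normalizedSum W n s (g - h) = normalizedSum W n s g - normalizedSum W n s h := by
  ext ω
  simp [normalizedSum, Finset.sum_sub_distrib, mul_sub]

variable [MeasurableSpace Ω] [MeasurableSpace α] {P : Measure Ω} {Q : Measure α}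

lemma measurable_normalizedSum (hW : ∀ i, Measurable (W i)) {g : α → ℝ} (hg : Measurable g)
    (n : ℕ) (s : Finset ι) : Measurable (normalizedSum W n s g) :=
  (Finset.measurable_fun_sum _ fun i _ => hg.comp (hW i)).const_mul _

/-- The triangle inequality alone, without cancellation: `n` terms over `√n` leave a factor `√n`.
This is the bound for the uncentered product error. -/
lemma eLpNorm_one_normalizedSum_le (hW : ∀ i, Measurable (W i)) (hlaw : ∀ i, P.map (W i) = Q)
    {g : α → ℝ} (hg : Measurable g) {n : ℕ} {s : Finset ι} (hs : s.card ≤ n) :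
    eLpNorm (normalizedSum W n s g) 1 P ≤ ENNReal.ofReal √(n : ℝ) * eLpNorm g 1 Q := by
  have hterm : ∀ i, eLpNorm (fun ω => g (W i ω)) 1 P = eLpNorm g 1 Q := fun i => by
    rw [← hlaw i, eLpNorm_map_measure hg.aestronglyMeasurable (hW i).aemeasurable]
    rfl
  have hsum : eLpNorm (fun ω => ∑ i ∈ s, g (W i ω)) 1 P ≤ (n : ℝ≥0∞) * eLpNorm g 1 Q := by
    calc eLpNorm (fun ω => ∑ i ∈ s, g (W i ω)) 1 P
        = eLpNorm (∑ i ∈ s, fun ω => g (W i ω)) 1 P := by congr 1; ext ω; simp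
      _ ≤ ∑ i ∈ s, eLpNorm (fun ω => g (W i ω)) 1 P :=
          eLpNorm_sum_le (fun i _ => (hg.comp (hW i)).aestronglyMeasurable) le_rfl
      _ = s.card * eLpNorm g 1 Q := by simp [hterm]
      _ ≤ _ := by gcongr
  have h1 : normalizedSum W n s g = (√(n : ℝ))⁻¹ • fun ω => ∑ i ∈ s, g (W i ω) := by
    ext ω; simp [normalizedSum]
  rw [h1, eLpNorm_const_smul]
  calc _ ≤ ‖(√(n : ℝ))⁻¹‖ₑ * ((n : ℝ≥0∞) * eLpNorm g 1 Q) := by gcongr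
    _ = ENNReal.ofReal √(n : ℝ) * eLpNorm g 1 Q := by
        rw [← mul_assoc, Real.enorm_eq_ofReal (by positivity), ← ENNReal.ofReal_natCast,
          ← ENNReal.ofReal_mul (by positivity)]
        congr 2
        rcases Nat.eq_zero_or_pos n with rfl | hn
        · simp
        · have : (0 : ℝ) < √(n : ℝ) := by positivity
          field_simp
          rw [Real.sq_sqrt (by positivity)]

/-- Variances of independent centered terms add, and the normalization cancels the number of terms,
so no power of `n` remains. The inequality `s.card ≤ n` is what is needed: `n` is the full sample
size while `s` indexes one sub-fold. -/
lemma eLpNorm_one_normalizedSum_le_of_integral_eq_zero [IsProbabilityMeasure P]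
    (hW : ∀ i, Measurable (W i)) (hlaw : ∀ i, P.map (W i) = Q) (hindep : iIndepFun W P)
    {g : α → ℝ} (hg : Measurable g) (hg2 : MemLp g 2 Q) (hg0 : ∫ x, g x ∂Q = 0)
    {n : ℕ} {s : Finset ι} (hs : s.card ≤ n) :
    eLpNorm (normalizedSum W n s g) 1 P ≤ eLpNorm g 2 Q := by
  have hmp : ∀ i, MeasurePreserving (W i) P Q := fun i => ⟨hW i, hlaw i⟩
  have hX : ∀ i, MemLp (fun ω => g (W i ω)) 2 P := fun i => hg2.comp_measurePreserving (hmp i)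
  have hX0 : ∀ i, ∫ ω, g (W i ω) ∂P = 0 := fun i => by
    rw [← hg0, ← hlaw i, integral_map (hW i).aemeasurable hg.aestronglyMeasurable]
  have hXV : ∀ i, Var[fun ω => g (W i ω); P] = ∫ x, g x ^ 2 ∂Q := fun i => by
    rw [variance_of_integral_eq_zero (hX i).aemeasurable (hX0 i), ← hlaw i,
      integral_map (hW i).aemeasurable (hg.pow_const 2).aestronglyMeasurable]
  have hsumV : Var[∑ i ∈ s, fun ω => g (W i ω); P] = s.card * ∫ x, g x ^ 2 ∂Q := by
    rw [IndepFun.variance_sum (fun i _ => hX i)]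
    · simp [hXV]
    · intro i _ j _ hij
      exact (hindep.indepFun hij).comp hg hg
  have hS : normalizedSum W n s g = fun ω => (√(n : ℝ))⁻¹ * (∑ i ∈ s, fun ω => g (W i ω)) ω := by
    ext ω; simp [normalizedSum]
  have hV : Var[normalizedSum W n s g; P] ≤ ∫ x, g x ^ 2 ∂Q := by
    rw [hS, variance_const_mul, hsumV, inv_pow, Real.sq_sqrt (by positivity), ← mul_assoc]
    refine mul_le_of_le_one_left (integral_nonneg fun x => sq_nonneg _) ?_
    rw [inv_mul_eq_div]
    exact div_le_one_of_le₀ (by exact_mod_cast hs) (by positivity)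
  have hL2 : MemLp (normalizedSum W n s g) 2 P := by
    rw [hS]
    exact (memLp_finsetSum' s fun i _ => hX i).const_mul _
  have h0 : ∫ ω, normalizedSum W n s g ω ∂P = 0 := by
    simp only [normalizedSum]
    rw [integral_const_mul, integral_finsetSum _ fun i _ => (hX i).integrable (by norm_num)]
    simp [hX0]
  calc eLpNorm (normalizedSum W n s g) 1 P ≤ eLpNorm (normalizedSum W n s g) 2 P :=
        eLpNorm_le_eLpNorm_of_exponent_le (by norm_num) hL2.1
    _ ≤ eLpNorm g 2 Q := by
        rw [eLpNorm_two_eq_ofReal_sqrt hL2, eLpNorm_two_eq_ofReal_sqrt hg2,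
          ← variance_of_integral_eq_zero hL2.aemeasurable h0]
        gcongr

end NormalizedSum

/-! ### One treatment arm: reweighting by the propensity and conditional moments of the residual. -/

section Arm

variable {𝓧 : Type*}

/-- The probability of the arm `d` under the propensity score `π`. -/
def armProp (π : 𝓧 → ℝ) (d : Fin 2) (x : 𝓧) : ℝ := if d = 1 then π x else 1 - π x

/-- The contribution of the arm `d` to the score, with outcome regression `m` and probability `ρ`
of the arm. -/
noncomputable def armScore (d : Fin 2) (m ρ : 𝓧 → ℝ) (w : Obs 𝓧) : ℝ :=
  m (cov w) + (if arm w = d then 1 else 0) * ((outcome w - m (cov w)) / ρ (cov w))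

/-- The residual of the outcome after regression on the arm and the covariates. -/
def residual (μ : Fin 2 → 𝓧 → ℝ) (w : Obs 𝓧) : ℝ := outcome w - μ (arm w) (cov w)

lemma treat_eq_ite (w : Obs 𝓧) : treat w = if arm w = 1 then 1 else 0 := by
  rcases w with ⟨d, y, x⟩
  fin_cases d <;> simp [treat, arm]

lemma one_sub_treat_eq_ite (w : Obs 𝓧) : 1 - treat w = if arm w = 0 then 1 else 0 := by
  rcases w with ⟨d, y, x⟩
  fin_cases d <;> simp [treat, arm]

/-- Separating the arms lets a single estimate, with `armProp` in place of the propensity, serve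
both. -/
lemma score_eq_armScore_sub (m : Fin 2 → 𝓧 → ℝ) (π : 𝓧 → ℝ) :
    score m π = armScore 1 (m 1) (armProp π 1) - armScore 0 (m 0) (armProp π 0) := by
  ext w
  simp only [score, armScore, Pi.sub_apply, treat_eq_ite w, armProp]
  rcases w with ⟨d, y, x⟩
  fin_cases d <;> simp [arm] <;> ring

lemma armProp_sub_abs (π p : 𝓧 → ℝ) (d : Fin 2) (x : 𝓧) :
    |armProp π d x - armProp p d x| = |π x - p x| := by
  unfold armProp
  split_ifs
  · rfl
  · rw [abs_sub_comm]; congr 1; ring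

lemma le_armProp {π : 𝓧 → ℝ} {ε : ℝ} {x : 𝓧} (h : ε ≤ π x ∧ π x ≤ 1 - ε) (d : Fin 2) :
    ε ≤ armProp π d x := by
  unfold armProp
  split_ifs <;> linarith

lemma armProp_le_one {π : 𝓧 → ℝ} {ε : ℝ} (hε : 0 < ε) {x : 𝓧} (h : ε ≤ π x ∧ π x ≤ 1 - ε)
    (d : Fin 2) : armProp π d x ≤ 1 := by
  unfold armProp
  split_ifs <;> linarith

variable [MeasurableSpace 𝓧]

lemma measurable_arm : Measurable (arm : Obs 𝓧 → Fin 2) := measurable_fst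

lemma measurable_outcome : Measurable (outcome : Obs 𝓧 → ℝ) := measurable_snd.fst

lemma measurable_cov : Measurable (cov : Obs 𝓧 → 𝓧) := measurable_snd.snd

lemma measurableSet_arm_eq (d : Fin 2) : MeasurableSet {w : Obs 𝓧 | arm w = d} :=
  measurable_arm (measurableSet_singleton d)

lemma measurable_armProp {π : 𝓧 → ℝ} (hπ : Measurable π) (d : Fin 2) :
    Measurable (armProp π d) := by
  unfold armProp
  split_ifs
  · exact hπ
  · exact measurable_const.sub hπ

lemma measurable_armIndicator (d : Fin 2) :
    Measurable fun w : Obs 𝓧 => (if arm w = d then 1 else 0 : ℝ) :=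
  Measurable.ite (measurableSet_arm_eq d) measurable_const measurable_const

lemma measurable_armScore (d : Fin 2) {m ρ : 𝓧 → ℝ} (hm : Measurable m) (hρ : Measurable ρ) :
    Measurable (armScore d m ρ) :=
  (hm.comp measurable_cov).add ((measurable_armIndicator d).mul
    ((measurable_outcome.sub (hm.comp measurable_cov)).div (hρ.comp measurable_cov)))

lemma measurable_uncurry_arm {μ : Fin 2 → 𝓧 → ℝ} (hμ : ∀ d, Measurable (μ d)) :
    Measurable (Function.uncurry μ) :=
  measurable_from_prod_countable_right hμ

lemma measurable_apply_arm_cov {μ : Fin 2 → 𝓧 → ℝ} (hμ : ∀ d, Measurable (μ d)) :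
    Measurable fun w : Obs 𝓧 => μ (arm w) (cov w) :=
  (measurable_uncurry_arm hμ).comp (measurable_arm.prodMk measurable_cov)

lemma measurable_residual {μ : Fin 2 → 𝓧 → ℝ} (hμ : ∀ d, Measurable (μ d)) :
    Measurable (residual μ) :=
  measurable_outcome.sub (measurable_apply_arm_cov hμ)

variable {Q : Measure (Obs 𝓧)} [IsProbabilityMeasure Q] {μ σ2 : Fin 2 → 𝓧 → ℝ} {p : 𝓧 → ℝ}

variable (𝓧) in
/-- The σ-algebra generated by the arm and the covariates. -/
abbrev armCovSigma : MeasurableSpace (Obs 𝓧) :=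
  MeasurableSpace.comap (fun w => (arm w, cov w)) inferInstance

namespace IsNuisance

lemma condExp_armIndicator (h : IsNuisance Q μ σ2 p) (d : Fin 2) :
    Q[fun w => (if arm w = d then 1 else 0 : ℝ) | MeasurableSpace.comap cov inferInstance]
      =ᵐ[Q] fun w => armProp p d (cov w) := by
  have hle := (measurable_cov (𝓧 := 𝓧)).comap_le
  have htr : (treat : Obs 𝓧 → ℝ) = fun w => if arm w = 1 then 1 else 0 := funext treat_eq_ite
  have hint : Integrable (treat : Obs 𝓧 → ℝ) Q := by
    rw [htr]
    refine Integrable.of_bound (measurable_armIndicator 1).aestronglyMeasurable 1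
      (ae_of_all _ fun w => ?_)
    split_ifs <;> simp
  match d with
  | 1 => rw [← htr]; exact h.propensity
  | 0 =>
    have h0 : (fun w : Obs 𝓧 => (if arm w = 0 then 1 else 0 : ℝ)) = (fun _ => 1) - treat := by
      ext w; simp [← one_sub_treat_eq_ite]
    rw [h0]
    filter_upwards [condExp_sub (integrable_const (1 : ℝ)) hint
      (MeasurableSpace.comap (cov : Obs 𝓧 → 𝓧) inferInstance), h.propensity] with w h1 h2
    rw [h1]
    simp [condExp_const hle, h2, armProp]

/-- The conditional probability of the arm, tested on events of the covariates. As an identity of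
measures it transfers to every measurable integrand, integrable or not; this is used for the
conditional variance, whose integrability against `Q` is not known beforehand. -/
lemma map_cov_restrict_arm (h : IsNuisance Q μ σ2 p) {d : Fin 2}
    (hp : ∀ᵐ w ∂Q, 0 ≤ armProp p d (cov w)) (hp1 : ∀ᵐ w ∂Q, armProp p d (cov w) ≤ 1) :
    (Q.restrict {w | arm w = d}).map cov
      = (Q.map cov).withDensity fun x => ENNReal.ofReal (armProp p d x) := by
  have hρ := measurable_armProp h.measurable_propensity d
  have hint : Integrable (fun w : Obs 𝓧 => (if arm w = d then 1 else 0 : ℝ)) Q := by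
    refine Integrable.of_bound (measurable_armIndicator d).aestronglyMeasurable 1
      (ae_of_all _ fun w => ?_)
    split_ifs <;> simp
  ext s hs
  rw [Measure.map_apply measurable_cov hs, Measure.restrict_apply (measurable_cov hs),
    withDensity_apply _ hs, setLIntegral_map hs hρ.ennreal_ofReal measurable_cov]
  have h1 := setIntegral_condExp (measurable_cov (𝓧 := 𝓧)).comap_le hint ⟨s, hs, rfl⟩
  rw [integral_congr_ae (ae_restrict_of_ae (h.condExp_armIndicator d))] at h1
  have hρint : Integrable (fun w => armProp p d (cov w)) Q := by
    refine Integrable.of_bound (hρ.comp measurable_cov).aestronglyMeasurable 1 ?_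
    filter_upwards [hp, hp1] with w h0 h1
    rwa [Real.norm_eq_abs, abs_of_nonneg h0]
  rw [← ofReal_integral_eq_lintegral_ofReal hρint.integrableOn (ae_restrict_of_ae hp), h1]
  have h2 : (fun w : Obs 𝓧 => (if arm w = d then 1 else 0 : ℝ))
      = {w | arm w = d}.indicator 1 := by
    ext w; simp [Set.indicator_apply]
  rw [h2, integral_indicator_one (measurableSet_arm_eq d), measureReal_def,
    ENNReal.ofReal_toReal (measure_ne_top _ _), Measure.restrict_apply (measurableSet_arm_eq d),
    Set.inter_comm]

lemma integral_armIndicator_mul (h : IsNuisance Q μ σ2 p) {d : Fin 2}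
    (hp : ∀ᵐ w ∂Q, 0 ≤ armProp p d (cov w)) (hp1 : ∀ᵐ w ∂Q, armProp p d (cov w) ≤ 1)
    {g : 𝓧 → ℝ} (hg : Measurable g) :
    ∫ w, (if arm w = d then 1 else 0) * g (cov w) ∂Q = ∫ w, armProp p d (cov w) * g (cov w) ∂Q := by
  have hρ := measurable_armProp h.measurable_propensity d
  have h1 : (fun w : Obs 𝓧 => (if arm w = d then 1 else 0) * g (cov w))
      = {w | arm w = d}.indicator fun w => g (cov w) := by
    ext w; simp [Set.indicator_apply]
  rw [h1, integral_indicator (measurableSet_arm_eq d),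
    ← integral_map (φ := cov) measurable_cov.aemeasurable hg.aestronglyMeasurable,
    h.map_cov_restrict_arm hp hp1,
    integral_withDensity_eq_integral_toReal_smul hρ.ennreal_ofReal (by simp),
    integral_map (φ := cov) (f := fun x => (ENNReal.ofReal (armProp p d x)).toReal • g x)
      measurable_cov.aemeasurable
      (hρ.ennreal_ofReal.ennreal_toReal.smul hg).aestronglyMeasurable]
  refine integral_congr_ae ?_
  filter_upwards [hp] with w hw
  simp [ENNReal.toReal_ofReal hw]

/-- The residual has conditional mean zero given the arm and the covariates, and `G` is measurable
with respect to these, so it can be pulled out. -/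
lemma integral_residual_mul (h : IsNuisance Q μ σ2 p) (hY : Integrable outcome Q)
    {G : Fin 2 × 𝓧 → ℝ} (hG : Measurable G)
    (hint : Integrable (fun w => residual μ w * G (arm w, cov w)) Q) :
    ∫ w, residual μ w * G (arm w, cov w) ∂Q = 0 := by
  have hle := ((measurable_arm (𝓧 := 𝓧)).prodMk measurable_cov).comap_le
  have hAX : Measurable[armCovSigma 𝓧] fun w : Obs 𝓧 => (arm w, cov w) := comap_measurable _
  have hμAX : StronglyMeasurable[armCovSigma 𝓧] fun w : Obs 𝓧 => μ (arm w) (cov w) :=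
    ((measurable_uncurry_arm h.measurable_mean).comp hAX).stronglyMeasurable
  have hμint : Integrable (fun w => μ (arm w) (cov w)) Q :=
    integrable_condExp.congr h.mean
  have he : Q[residual μ | armCovSigma 𝓧] =ᵐ[Q] 0 := by
    have h1 : residual μ = outcome - fun w => μ (arm w) (cov w) := rfl
    rw [h1]
    filter_upwards [condExp_sub hY hμint (armCovSigma 𝓧), h.mean] with w h2 h3
    rw [h2, Pi.sub_apply, condExp_of_stronglyMeasurable hle hμAX hμint, h3]
    simp
  have hpull := condExp_mul_of_stronglyMeasurable_right (m := armCovSigma 𝓧) (μ := Q)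
    (f := residual μ) (g := fun w => G (arm w, cov w))
    (hG.comp hAX).stronglyMeasurable hint (hY.sub hμint)
  calc ∫ w, residual μ w * G (arm w, cov w) ∂Q
      = ∫ w, Q[residual μ * fun w => G (arm w, cov w) | armCovSigma 𝓧] w ∂Q :=
        (integral_condExp hle).symm
    _ = ∫ w, 0 ∂Q := by
        refine integral_congr_ae ?_
        filter_upwards [hpull, he] with w h1 h2
        rw [h1, Pi.mul_apply, h2]
        simp
    _ = 0 := by simp

lemma integral_residual_sq_mul (h : IsNuisance Q μ σ2 p) (hres : MemLp (residual μ) 2 Q)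
    {G : Fin 2 × 𝓧 → ℝ} (hG : Measurable G)
    (hint : Integrable (fun w => residual μ w ^ 2 * G (arm w, cov w)) Q) :
    ∫ w, residual μ w ^ 2 * G (arm w, cov w) ∂Q
      = ∫ w, σ2 (arm w) (cov w) * G (arm w, cov w) ∂Q := by
  have hle := ((measurable_arm (𝓧 := 𝓧)).prodMk measurable_cov).comap_le
  have hAX : Measurable[armCovSigma 𝓧] fun w : Obs 𝓧 => (arm w, cov w) := comap_measurable _
  have hvar : Q[residual μ ^ 2 | armCovSigma 𝓧] =ᵐ[Q] fun w => σ2 (arm w) (cov w) := by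
    refine EventuallyEq.trans (condExp_congr_ae ?_) h.variance
    filter_upwards [h.mean] with w hw
    simp only [Pi.pow_apply, Pi.sub_apply]
    rw [hw]
    rfl
  have hpull := condExp_mul_of_stronglyMeasurable_right (m := armCovSigma 𝓧) (μ := Q)
    (f := residual μ ^ 2) (g := fun w => G (arm w, cov w))
    (hG.comp hAX).stronglyMeasurable hint hres.integrable_sq
  calc ∫ w, residual μ w ^ 2 * G (arm w, cov w) ∂Q
      = ∫ w, Q[residual μ ^ 2 * fun w => G (arm w, cov w) | armCovSigma 𝓧] w ∂Q :=
        (integral_condExp hle).symm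
    _ = _ := by
        refine integral_congr_ae ?_
        filter_upwards [hpull, hvar] with w h1 h2
        rw [h1, Pi.mul_apply, h2]

end IsNuisance

end Arm

/-! ### Exact decomposition of the error in one arm, and bounds for its three parts. -/

section Decomposition

variable {𝓧 : Type*}

/-- The centered part of the error of the score due to the outcome regression `m`. -/
noncomputable def regressionError (d : Fin 2) (m₀ m ρ₀ : 𝓧 → ℝ) (w : Obs 𝓧) : ℝ :=
  (m (cov w) - m₀ (cov w)) * (1 - (if arm w = d then 1 else 0) * (ρ₀ (cov w))⁻¹)

/-- The centered part of the error of the score due to the propensity `ρ`. -/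
noncomputable def weightError (d : Fin 2) (μ : Fin 2 → 𝓧 → ℝ) (ρ₀ ρ : 𝓧 → ℝ) (w : Obs 𝓧) : ℝ :=
  residual μ w * ((if arm w = d then 1 else 0) * ((ρ (cov w))⁻¹ - (ρ₀ (cov w))⁻¹))

/-- The product of the errors of the outcome regression and of the propensity. -/
noncomputable def productError (d : Fin 2) (m₀ m ρ₀ ρ : 𝓧 → ℝ) (w : Obs 𝓧) : ℝ :=
  (if arm w = d then 1 else 0) * ((m (cov w) - m₀ (cov w)) * ((ρ₀ (cov w))⁻¹ - (ρ (cov w))⁻¹))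

/-- This is the orthogonality of the score. On the arm `d`, the quantity `Y - m` is the residual
minus the regression error; expanding leaves two terms of first order, both centered, and one
product of errors. -/
lemma armScore_sub_eq (d : Fin 2) (μ : Fin 2 → 𝓧 → ℝ) (m ρ₀ ρ : 𝓧 → ℝ) :
    armScore d m ρ - armScore d (μ d) ρ₀
      = regressionError d (μ d) m ρ₀ + weightError d μ ρ₀ ρ + productError d (μ d) m ρ₀ ρ := by
  ext w
  simp only [armScore, regressionError, weightError, productError, residual, Pi.sub_apply,
    Pi.add_apply]
  split_ifs with h
  · rw [h]; ring
  · ring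

lemma abs_inv_sub_inv_le {ε a b : ℝ} (hε : 0 < ε) (ha : ε ≤ a) (hb : ε ≤ b) :
    |a⁻¹ - b⁻¹| ≤ ε⁻¹ := by
  have h1 : a⁻¹ ≤ ε⁻¹ := inv_anti₀ hε ha
  have h2 : b⁻¹ ≤ ε⁻¹ := inv_anti₀ hε hb
  have h3 : 0 < a⁻¹ := inv_pos.2 (hε.trans_le ha)
  have h4 : 0 < b⁻¹ := inv_pos.2 (hε.trans_le hb)
  rw [abs_le]
  constructor <;> linarith

lemma abs_inv_sub_inv_le_mul {ε a b : ℝ} (hε : 0 < ε) (ha : ε ≤ a) (hb : ε ≤ b) :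
    |a⁻¹ - b⁻¹| ≤ ε⁻¹ ^ 2 * |a - b| := by
  have ha' : 0 < a := hε.trans_le ha
  have hb' : 0 < b := hε.trans_le hb
  have h : a⁻¹ - b⁻¹ = a⁻¹ * b⁻¹ * (b - a) := by field_simp
  rw [h, abs_mul, abs_sub_comm b a, abs_of_pos (by positivity : 0 < a⁻¹ * b⁻¹), sq]
  gcongr

lemma norm_regressionError_le {ε : ℝ} (hε : 0 < ε) (d : Fin 2) (m₀ m : 𝓧 → ℝ)
    {ρ₀ : 𝓧 → ℝ} {w : Obs 𝓧}
    (h : ε ≤ ρ₀ (cov w)) (h1 : ρ₀ (cov w) ≤ 1) :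
    ‖regressionError d m₀ m ρ₀ w‖ ≤ ε⁻¹ * ‖m (cov w) - m₀ (cov w)‖ := by
  have h2 : (ρ₀ (cov w))⁻¹ ≤ ε⁻¹ := inv_anti₀ hε h
  have h3 : 1 ≤ (ρ₀ (cov w))⁻¹ := (one_le_inv₀ (hε.trans_le h)).2 h1
  rw [regressionError, norm_mul, mul_comm, Real.norm_eq_abs]
  gcongr
  rw [abs_le]
  split_ifs <;> constructor <;> linarith

lemma norm_weightError_le {ε : ℝ} (hε : 0 < ε) (d : Fin 2) {μ : Fin 2 → 𝓧 → ℝ}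
    {ρ₀ ρ : 𝓧 → ℝ} {w : Obs 𝓧}
    (h₀ : ε ≤ ρ₀ (cov w)) (h : ε ≤ ρ (cov w)) :
    ‖weightError d μ ρ₀ ρ w‖ ≤ ε⁻¹ * ‖residual μ w‖ := by
  have h1 := abs_inv_sub_inv_le hε h h₀
  rw [weightError, norm_mul, norm_mul, mul_comm]
  gcongr
  calc _ ≤ 1 * ε⁻¹ := by
        gcongr
        · split_ifs <;> simp
        · exact h1
    _ = _ := one_mul _

variable [MeasurableSpace 𝓧] {μ σ2 : Fin 2 → 𝓧 → ℝ} {p : 𝓧 → ℝ}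
  {Q : Measure (Obs 𝓧)} {ε : ℝ}

lemma measurable_regressionError (d : Fin 2) {m₀ m ρ₀ : 𝓧 → ℝ} (hm₀ : Measurable m₀)
    (hm : Measurable m) (hρ₀ : Measurable ρ₀) : Measurable (regressionError d m₀ m ρ₀) :=
  ((hm.comp measurable_cov).sub (hm₀.comp measurable_cov)).mul
    (measurable_const.sub ((measurable_armIndicator d).mul (hρ₀.comp measurable_cov).inv))

lemma measurable_weightError (d : Fin 2) (hμ : ∀ d, Measurable (μ d)) {ρ₀ ρ : 𝓧 → ℝ}
    (hρ₀ : Measurable ρ₀) (hρ : Measurable ρ) : Measurable (weightError d μ ρ₀ ρ) :=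
  (measurable_residual hμ).mul ((measurable_armIndicator d).mul
    ((hρ.comp measurable_cov).inv.sub (hρ₀.comp measurable_cov).inv))

lemma measurable_productError (d : Fin 2) {m₀ m ρ₀ ρ : 𝓧 → ℝ} (hm₀ : Measurable m₀)
    (hm : Measurable m) (hρ₀ : Measurable ρ₀) (hρ : Measurable ρ) :
    Measurable (productError d m₀ m ρ₀ ρ) :=
  (measurable_armIndicator d).mul (((hm.comp measurable_cov).sub (hm₀.comp measurable_cov)).mul
    ((hρ₀.comp measurable_cov).inv.sub (hρ.comp measurable_cov).inv))

lemma eLpNorm_regressionError_le (hε : 0 < ε) (d : Fin 2) (m₀ m : 𝓧 → ℝ) {ρ₀ : 𝓧 → ℝ}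
    (h : ∀ᵐ w ∂Q, ε ≤ ρ₀ (cov w)) (h1 : ∀ᵐ w ∂Q, ρ₀ (cov w) ≤ 1) :
    eLpNorm (regressionError d m₀ m ρ₀) 2 Q
      ≤ ENNReal.ofReal ε⁻¹ * normX Q 2 (fun x => m x - m₀ x) := by
  refine eLpNorm_le_mul_eLpNorm_of_ae_le_mul ?_ 2
  filter_upwards [h, h1] with w h2 h3 using norm_regressionError_le hε d m₀ m h2 h3

lemma eLpNorm_productError_le (hε : 0 < ε) (d : Fin 2) {m₀ m ρ₀ ρ : 𝓧 → ℝ}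
    (hm₀ : Measurable m₀) (hm : Measurable m) (hρ₀ : Measurable ρ₀) (hρ : Measurable ρ)
    (h₀ : ∀ᵐ w ∂Q, ε ≤ ρ₀ (cov w)) (h : ∀ᵐ w ∂Q, ε ≤ ρ (cov w)) :
    eLpNorm (productError d m₀ m ρ₀ ρ) 1 Q ≤ ENNReal.ofReal (ε⁻¹ ^ 2) *
      (normX Q 2 (fun x => m x - m₀ x) * normX Q 2 (fun x => ρ x - ρ₀ x)) := by
  calc eLpNorm (productError d m₀ m ρ₀ ρ) 1 Q
      ≤ ENNReal.ofReal (ε⁻¹ ^ 2) * eLpNorm ((fun w => m (cov w) - m₀ (cov w)) •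
          fun w => ρ (cov w) - ρ₀ (cov w)) 1 Q := by
        refine eLpNorm_le_mul_eLpNorm_of_ae_le_mul ?_ 1
        filter_upwards [h₀, h] with w h1 h2
        have h3 := abs_inv_sub_inv_le_mul hε h1 h2
        rw [abs_sub_comm (ρ₀ (cov w))] at h3
        simp only [productError, Pi.smul_apply', smul_eq_mul, norm_mul]
        calc _ ≤ 1 * (‖m (cov w) - m₀ (cov w)‖ * (ε⁻¹ ^ 2 * ‖ρ (cov w) - ρ₀ (cov w)‖)) := by
              gcongr
              · split_ifs <;> simp
              · exact h3
          _ = _ := by ring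
    _ ≤ _ := by
        gcongr
        exact eLpNorm_smul_le_mul_eLpNorm
          ((hρ.comp measurable_cov).sub (hρ₀.comp measurable_cov)).aestronglyMeasurable
          ((hm.comp measurable_cov).sub (hm₀.comp measurable_cov)).aestronglyMeasurable

/-- The `L²` norm of the large values of the residual. -/
noncomputable def residualTail (Q : Measure (Obs 𝓧)) (μ : Fin 2 → 𝓧 → ℝ) (T : ℝ) : ℝ≥0∞ :=
  eLpNorm ({w | T ≤ ‖residual μ w‖₊}.indicator (residual μ)) 2 Q

lemma exists_residualTail_le (hμ : ∀ d, Measurable (μ d)) (hres : MemLp (residual μ) 2 Q) {δ : ℝ}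
    (hδ : 0 < δ) : ∃ T, 0 < T ∧ residualTail Q μ T ≤ ENNReal.ofReal δ :=
  hres.eLpNorm_indicator_norm_ge_pos_le (measurable_residual hμ).stronglyMeasurable hδ

/-- The residual has only two moments, so its product with the propensity error is not controlled in
`L²` by the `L²` size of the latter. Truncation at `T` repairs this: below `T` the residual is
bounded and the propensity error enters linearly; above `T` the difference of inverses is at most
`ε⁻¹` and only the tail of the residual remains. -/
lemma eLpNorm_weightError_le (hε : 0 < ε) (d : Fin 2) (hμ : ∀ d, Measurable (μ d))
    {ρ₀ ρ : 𝓧 → ℝ} (hρ₀ : Measurable ρ₀) (hρ : Measurable ρ)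
    (h₀ : ∀ᵐ w ∂Q, ε ≤ ρ₀ (cov w)) (h : ∀ᵐ w ∂Q, ε ≤ ρ (cov w)) {T : ℝ} (hT : 0 ≤ T) :
    eLpNorm (weightError d μ ρ₀ ρ) 2 Q
      ≤ ENNReal.ofReal (T * ε⁻¹ ^ 2) * normX Q 2 (fun x => ρ x - ρ₀ x)
        + ENNReal.ofReal ε⁻¹ * residualTail Q μ T := by
  set S : Set (Obs 𝓧) := {w | T ≤ ‖residual μ w‖₊} with hS
  have hSm : MeasurableSet S :=
    measurableSet_le measurable_const (measurable_residual hμ).nnnorm.coe_nnreal_real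
  have hwm := measurable_weightError d hμ hρ₀ hρ
  have hdecomp : weightError d μ ρ₀ ρ
      = Sᶜ.indicator (weightError d μ ρ₀ ρ) + S.indicator (weightError d μ ρ₀ ρ) :=
    (Set.indicator_compl_add_self _ _).symm
  rw [hdecomp]
  refine (eLpNorm_add_le (hwm.indicator hSm.compl).aestronglyMeasurable
    (hwm.indicator hSm).aestronglyMeasurable (by norm_num)).trans (add_le_add ?_ ?_)
  · refine eLpNorm_le_mul_eLpNorm_of_ae_le_mul ?_ 2
    filter_upwards [h₀, h] with w h1 h2
    by_cases hw : w ∈ S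
    · rw [Set.indicator_of_notMem (by simpa using hw), norm_zero]
      positivity
    · rw [Set.indicator_of_mem hw]
      have h3 : ‖residual μ w‖ ≤ T := by
        simpa [hS] using le_of_lt (lt_of_not_ge hw)
      have h4 := abs_inv_sub_inv_le_mul hε h2 h1
      rw [weightError, norm_mul, norm_mul]
      calc _ ≤ T * (1 * (ε⁻¹ ^ 2 * ‖ρ (cov w) - ρ₀ (cov w)‖)) := by
            gcongr
            · split_ifs <;> simp
            · exact h4
        _ = _ := by ring
  · refine eLpNorm_le_mul_eLpNorm_of_ae_le_mul ?_ 2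
    filter_upwards [h₀, h] with w h1 h2
    by_cases hw : w ∈ S
    · rw [Set.indicator_of_mem hw, Set.indicator_of_mem hw]
      exact norm_weightError_le hε d h1 h2
    · rw [Set.indicator_of_notMem hw, Set.indicator_of_notMem hw]
      simp

lemma memLp_weightError (hε : 0 < ε) (d : Fin 2) (hμ : ∀ d, Measurable (μ d))
    (hres : MemLp (residual μ) 2 Q) {ρ₀ ρ : 𝓧 → ℝ} (hρ₀ : Measurable ρ₀) (hρ : Measurable ρ)
    (h₀ : ∀ᵐ w ∂Q, ε ≤ ρ₀ (cov w)) (h : ∀ᵐ w ∂Q, ε ≤ ρ (cov w)) :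
    MemLp (weightError d μ ρ₀ ρ) 2 Q := by
  refine MemLp.of_le_mul (c := ε⁻¹) hres
    (measurable_weightError d hμ hρ₀ hρ).aestronglyMeasurable ?_
  filter_upwards [h₀, h] with w h1 h2 using norm_weightError_le hε d h1 h2

variable [IsProbabilityMeasure Q]

/-- The factor `1 - 1{arm = d} / ρ₀` has conditional mean zero given the covariates when `ρ₀` is the
true probability of the arm. -/
lemma integral_regressionError (hnuis : IsNuisance Q μ σ2 p) (hε : 0 < ε)
    (hov : ∀ᵐ w ∂Q, ε ≤ p (cov w) ∧ p (cov w) ≤ 1 - ε) {d : Fin 2} {m₀ m : 𝓧 → ℝ}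
    (hm₀ : Measurable m₀) (hm : Measurable m)
    (hfin : MemLp (fun w => m (cov w) - m₀ (cov w)) 2 Q) :
    ∫ w, regressionError d m₀ m (armProp p d) w ∂Q = 0 := by
  have hρ := measurable_armProp hnuis.measurable_propensity d
  have hint := hfin.integrable (by norm_num)
  have hερ : ∀ᵐ w ∂Q, ε ≤ armProp p d (cov w) := hov.mono fun w hw => le_armProp hw d
  have hρ1 : ∀ᵐ w ∂Q, armProp p d (cov w) ≤ 1 := hov.mono fun w hw => armProp_le_one hε hw d
  have hregint : Integrable (regressionError d m₀ m (armProp p d)) Q := by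
    refine (MemLp.of_le_mul (c := ε⁻¹) hfin
      (measurable_regressionError d hm₀ hm hρ).aestronglyMeasurable ?_).integrable
      (one_le_two)
    filter_upwards [hερ, hρ1] with w h2 h3 using norm_regressionError_le hε d m₀ m h2 h3
  have hg : Measurable fun x => (m x - m₀ x) * (armProp p d x)⁻¹ := (hm.sub hm₀).mul hρ.inv
  have h1 := hnuis.integral_armIndicator_mul (hερ.mono fun w hw => hε.le.trans hw) hρ1 hg
  have h2 : ∫ w, armProp p d (cov w) * ((m (cov w) - m₀ (cov w)) * (armProp p d (cov w))⁻¹) ∂Q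
      = ∫ w, (m (cov w) - m₀ (cov w)) ∂Q := by
    refine integral_congr_ae ?_
    filter_upwards [hερ] with w hw
    have : armProp p d (cov w) ≠ 0 := (hε.trans_le hw).ne'
    field_simp
  have h3 : (fun w : Obs 𝓧 => (if arm w = d then 1 else 0) *
        ((m (cov w) - m₀ (cov w)) * (armProp p d (cov w))⁻¹))
      = (fun w => m (cov w) - m₀ (cov w)) - regressionError d m₀ m (armProp p d) := by
    ext w
    simp only [regressionError, Pi.sub_apply]
    ring
  rw [h2, h3, integral_sub' hint hregint] at h1
  linarith

/-- Centering comes from the residual alone, so `ρ₀` and `ρ` may be arbitrary functions, subject to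
integrability. -/
lemma integral_weightError (hnuis : IsNuisance Q μ σ2 p) (hY : Integrable outcome Q)
    (d : Fin 2) {ρ₀ ρ : 𝓧 → ℝ} (hρ₀ : Measurable ρ₀) (hρ : Measurable ρ)
    (hint : Integrable (weightError d μ ρ₀ ρ) Q) :
    ∫ w, weightError d μ ρ₀ ρ w ∂Q = 0 :=
  hnuis.integral_residual_mul hY
    (G := fun z => (if z.1 = d then 1 else 0) * ((ρ z.2)⁻¹ - (ρ₀ z.2)⁻¹))
    ((Measurable.ite (measurable_fst (measurableSet_singleton d)) measurable_const
      measurable_const).mul ((hρ.comp measurable_snd).inv.sub (hρ₀.comp measurable_snd).inv)) hint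

/-- A bound of the error of the normalized sum of the contributions of one arm that depends on the
fitted functions through their `L²` errors only. -/
lemma eLpNorm_normalizedSum_armScore_sub_le {Ω ι : Type*} [MeasurableSpace Ω] {P : Measure Ω}
    [IsProbabilityMeasure P] {W : ι → Ω → Obs 𝓧} (hW : ∀ i, Measurable (W i))
    (hlaw : ∀ i, P.map (W i) = Q) (hindep : iIndepFun W P) (hnuis : IsNuisance Q μ σ2 p)
    (hε : 0 < ε) (hov : ∀ᵐ w ∂Q, ε ≤ p (cov w) ∧ p (cov w) ≤ 1 - ε)
    (hY : Integrable outcome Q) (hres : MemLp (residual μ) 2 Q) (d : Fin 2) {m π : 𝓧 → ℝ}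
    (hm : Measurable m) (hfin : normX Q 2 (fun x => m x - μ d x) < ∞) (hπ : Measurable π)
    (hπov : ∀ᵐ w ∂Q, ε ≤ π (cov w) ∧ π (cov w) ≤ 1 - ε) {T : ℝ} (hT : 0 ≤ T)
    {n : ℕ} {s : Finset ι} (hs : s.card ≤ n) :
    eLpNorm (normalizedSum W n s
        (armScore d m (armProp π d) - armScore d (μ d) (armProp p d))) 1 P
      ≤ ENNReal.ofReal ε⁻¹ * normX Q 2 (fun x => m x - μ d x)
        + (ENNReal.ofReal (T * ε⁻¹ ^ 2) * normX Q 2 (fun x => π x - p x)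
          + ENNReal.ofReal ε⁻¹ * residualTail Q μ T)
        + ENNReal.ofReal √(n : ℝ) * (ENNReal.ofReal (ε⁻¹ ^ 2) *
          (normX Q 2 (fun x => m x - μ d x) * normX Q 2 (fun x => π x - p x))) := by
  have hμ := hnuis.measurable_mean
  have hρ₀ := measurable_armProp hnuis.measurable_propensity d
  have hρ := measurable_armProp hπ d
  have h₀ : ∀ᵐ w ∂Q, ε ≤ armProp p d (cov w) := hov.mono fun w hw => le_armProp hw d
  have h : ∀ᵐ w ∂Q, ε ≤ armProp π d (cov w) := hπov.mono fun w hw => le_armProp hw d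
  have h₀1 : ∀ᵐ w ∂Q, armProp p d (cov w) ≤ 1 := hov.mono fun w hw => armProp_le_one hε hw d
  have hnorm : normX Q 2 (fun x => armProp π d x - armProp p d x)
      = normX Q 2 (fun x => π x - p x) :=
    eLpNorm_congr_norm_ae (ae_of_all _ fun w => armProp_sub_abs π p d (cov w))
  have hmLp : MemLp (fun w => m (cov w) - μ d (cov w)) 2 Q :=
    ⟨((hm.comp measurable_cov).sub ((hμ d).comp measurable_cov)).aestronglyMeasurable, hfin⟩
  have hAm := measurable_regressionError d (hμ d) hm hρ₀
  have hBm := measurable_weightError d hμ hρ₀ hρ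
  have hCm := measurable_productError d (hμ d) hm hρ₀ hρ
  have hA2 : MemLp (regressionError d (μ d) m (armProp p d)) 2 Q :=
    ⟨hAm.aestronglyMeasurable, (eLpNorm_regressionError_le hε d (μ d) m h₀ h₀1).trans_lt
      (ENNReal.mul_lt_top ENNReal.ofReal_lt_top hfin)⟩
  have hB2 := memLp_weightError hε d hμ hres hρ₀ hρ h₀ h
  have hN : ∀ {g : Obs 𝓧 → ℝ}, Measurable g → AEStronglyMeasurable (normalizedSum W n s g) P :=
    fun hg => (measurable_normalizedSum hW hg n s).aestronglyMeasurable
  rw [armScore_sub_eq, normalizedSum_add, normalizedSum_add]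
  refine (eLpNorm_add_le ((hN hAm).add (hN hBm)) (hN hCm) le_rfl).trans (add_le_add
    ((eLpNorm_add_le (hN hAm) (hN hBm) le_rfl).trans (add_le_add ?_ ?_)) ?_)
  · exact (eLpNorm_one_normalizedSum_le_of_integral_eq_zero hW hlaw hindep hAm hA2
      (integral_regressionError hnuis hε hov (hμ d) hm hmLp) hs).trans
      (eLpNorm_regressionError_le hε d (μ d) m h₀ h₀1)
  · rw [← hnorm]
    exact (eLpNorm_one_normalizedSum_le_of_integral_eq_zero hW hlaw hindep hBm hB2
      (integral_weightError hnuis hY d hρ₀ hρ (hB2.integrable one_le_two)) hs).trans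
      (eLpNorm_weightError_le hε d hμ hρ₀ hρ h₀ h hT)
  · rw [← hnorm]
    refine (eLpNorm_one_normalizedSum_le hW hlaw hCm hs).trans ?_
    gcongr
    exact eLpNorm_productError_le hε d (hμ d) hm hρ₀ hρ h₀ h

end Decomposition

/-! ### Mean and variance of the oracle score. -/

section Score

variable {𝓧 : Type*}

/-- The inverse probability weight of the residual in the score. -/
noncomputable def signedWeight (p : 𝓧 → ℝ) (z : Fin 2 × 𝓧) : ℝ :=
  (if z.1 = 1 then 1 else 0) * (armProp p 1 z.2)⁻¹
    - (if z.1 = 0 then 1 else 0) * (armProp p 0 z.2)⁻¹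

/-- The second summand is the residual times a function of the arm and the covariates, hence
centered and orthogonal to the effect. Mean and variance of the score are read off from this form.
-/
lemma score_eq_add_residual_mul (μ : Fin 2 → 𝓧 → ℝ) (p : 𝓧 → ℝ) :
    score μ p = (fun w => μ 1 (cov w) - μ 0 (cov w))
      + fun w => residual μ w * signedWeight p (arm w, cov w) := by
  rw [score_eq_armScore_sub]
  ext ⟨d, y, x⟩
  fin_cases d <;> simp [armScore, residual, signedWeight, arm, outcome, cov] <;> ring

lemma signedWeight_sq (p : 𝓧 → ℝ) (z : Fin 2 × 𝓧) :
    signedWeight p z ^ 2 = (if z.1 = 1 then 1 else 0) * (armProp p 1 z.2)⁻¹ ^ 2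
      + (if z.1 = 0 then 1 else 0) * (armProp p 0 z.2)⁻¹ ^ 2 := by
  rcases z with ⟨d, x⟩
  fin_cases d <;> simp [signedWeight]

lemma abs_signedWeight_le {p : 𝓧 → ℝ} {ε : ℝ} (hε : 0 < ε) {x : 𝓧} (h : ε ≤ p x ∧ p x ≤ 1 - ε)
    (d : Fin 2) : |signedWeight p (d, x)| ≤ ε⁻¹ := by
  have key : ∀ d, |(armProp p d x)⁻¹| ≤ ε⁻¹ := fun d => by
    rw [abs_of_pos (inv_pos.2 (hε.trans_le (le_armProp h d)))]
    exact inv_anti₀ hε (le_armProp h d)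
  fin_cases d
  · simpa [signedWeight] using key 0
  · simpa [signedWeight] using key 1

variable [MeasurableSpace 𝓧] {μ σ2 : Fin 2 → 𝓧 → ℝ} {p : 𝓧 → ℝ}
  {Q : Measure (Obs 𝓧)} {ε : ℝ}

lemma measurable_signedWeight (hp : Measurable p) : Measurable (signedWeight p) :=
  ((Measurable.ite (measurable_fst (measurableSet_singleton 1)) measurable_const
    measurable_const).mul ((measurable_armProp hp 1).comp measurable_snd).inv).sub
  ((Measurable.ite (measurable_fst (measurableSet_singleton 0)) measurable_const
    measurable_const).mul ((measurable_armProp hp 0).comp measurable_snd).inv)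

lemma measurable_score {m : Fin 2 → 𝓧 → ℝ} (hm : ∀ d, Measurable (m d)) {π : 𝓧 → ℝ}
    (hπ : Measurable π) : Measurable (score m π) := by
  rw [score_eq_armScore_sub]
  exact (measurable_armScore 1 (hm 1) (measurable_armProp hπ 1)).sub
    (measurable_armScore 0 (hm 0) (measurable_armProp hπ 0))

lemma memLp_residual_mul_signedWeight (hε : 0 < ε) (hμ : ∀ d, Measurable (μ d))
    (hp : Measurable p) (hov : ∀ᵐ w ∂Q, ε ≤ p (cov w) ∧ p (cov w) ≤ 1 - ε)
    (hres : MemLp (residual μ) 2 Q) :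
    MemLp (fun w => residual μ w * signedWeight p (arm w, cov w)) 2 Q := by
  refine MemLp.of_le_mul (c := ε⁻¹) hres ((measurable_residual hμ).mul
    ((measurable_signedWeight hp).comp
      (measurable_arm.prodMk measurable_cov))).aestronglyMeasurable ?_
  filter_upwards [hov] with w hw
  rw [norm_mul, mul_comm]
  gcongr
  exact abs_signedWeight_le hε hw _

lemma memLp_score (hε : 0 < ε) (hμ : ∀ d, Measurable (μ d))
    (hp : Measurable p) (hov : ∀ᵐ w ∂Q, ε ≤ p (cov w) ∧ p (cov w) ≤ 1 - ε)
    (hres : MemLp (residual μ) 2 Q)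
    (heff : MemLp (fun w => μ 1 (cov w) - μ 0 (cov w)) 2 Q) : MemLp (score μ p) 2 Q := by
  rw [score_eq_add_residual_mul]
  exact heff.add (memLp_residual_mul_signedWeight hε hμ hp hov hres)

variable [IsProbabilityMeasure Q]

namespace IsNuisance

lemma integral_residual_mul_signedWeight (hnuis : IsNuisance Q μ σ2 p) (hε : 0 < ε)
    (hov : ∀ᵐ w ∂Q, ε ≤ p (cov w) ∧ p (cov w) ≤ 1 - ε) (hY : Integrable outcome Q)
    (hres : MemLp (residual μ) 2 Q) :
    ∫ w, residual μ w * signedWeight p (arm w, cov w) ∂Q = 0 :=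
  hnuis.integral_residual_mul hY (measurable_signedWeight hnuis.measurable_propensity)
    ((memLp_residual_mul_signedWeight hε hnuis.measurable_mean hnuis.measurable_propensity hov
      hres).integrable one_le_two)

lemma integral_score (hnuis : IsNuisance Q μ σ2 p) (hε : 0 < ε)
    (hov : ∀ᵐ w ∂Q, ε ≤ p (cov w) ∧ p (cov w) ≤ 1 - ε) (hY : Integrable outcome Q)
    (hres : MemLp (residual μ) 2 Q) (heff : MemLp (fun w => μ 1 (cov w) - μ 0 (cov w)) 2 Q) :
    ∫ w, score μ p w ∂Q = target Q μ := by
  rw [score_eq_add_residual_mul, integral_add' (heff.integrable one_le_two)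
    ((memLp_residual_mul_signedWeight hε hnuis.measurable_mean hnuis.measurable_propensity hov
      hres).integrable one_le_two), hnuis.integral_residual_mul_signedWeight hε hov hY hres,
    add_zero, target]

/-- The second moment of the inverse probability weighted residual in one arm. -/
lemma integral_residual_sq_mul_armIndicator (hnuis : IsNuisance Q μ σ2 p) (hε : 0 < ε)
    (hov : ∀ᵐ w ∂Q, ε ≤ p (cov w) ∧ p (cov w) ≤ 1 - ε) (hres : MemLp (residual μ) 2 Q)
    (d : Fin 2) :
    Integrable (fun w => residual μ w ^ 2 *
        ((if arm w = d then 1 else 0) * (armProp p d (cov w))⁻¹ ^ 2)) Q ∧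
      ∫ w, residual μ w ^ 2 * ((if arm w = d then 1 else 0) * (armProp p d (cov w))⁻¹ ^ 2) ∂Q
        = ∫ w, σ2 d (cov w) / armProp p d (cov w) ∂Q := by
  have hρ := measurable_armProp hnuis.measurable_propensity d
  have hερ : ∀ᵐ w ∂Q, ε ≤ armProp p d (cov w) := hov.mono fun w hw => le_armProp hw d
  have hρ1 : ∀ᵐ w ∂Q, armProp p d (cov w) ≤ 1 := hov.mono fun w hw => armProp_le_one hε hw d
  have hG : Measurable fun z : Fin 2 × 𝓧 =>
      (if z.1 = d then 1 else 0) * (armProp p d z.2)⁻¹ ^ 2 :=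
    (Measurable.ite (measurable_fst (measurableSet_singleton d)) measurable_const
      measurable_const).mul ((hρ.comp measurable_snd).inv.pow_const 2)
  have hint : Integrable (fun w => residual μ w ^ 2 *
      ((if arm w = d then 1 else 0) * (armProp p d (cov w))⁻¹ ^ 2)) Q := by
    refine hres.integrable_sq.mul_bdd (c := ε⁻¹ ^ 2)
      (hG.comp (measurable_arm.prodMk measurable_cov)).aestronglyMeasurable ?_
    filter_upwards [hερ] with w hw
    have h0 : 0 ≤ (armProp p d (cov w))⁻¹ := inv_nonneg.2 (hε.le.trans hw)
    have h1 : (armProp p d (cov w))⁻¹ ≤ ε⁻¹ := inv_anti₀ hε hw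
    simp only [norm_mul, norm_pow, Real.norm_of_nonneg h0]
    calc _ ≤ 1 * ε⁻¹ ^ 2 := by
          gcongr
          split_ifs <;> simp
      _ = _ := one_mul _
  refine ⟨hint, ?_⟩
  rw [hnuis.integral_residual_sq_mul hres hG hint]
  have h1 : (fun w : Obs 𝓧 => σ2 (arm w) (cov w) *
        ((if arm w = d then 1 else 0) * (armProp p d (cov w))⁻¹ ^ 2))
      = fun w => (if arm w = d then 1 else 0) *
        (σ2 d (cov w) * (armProp p d (cov w))⁻¹ ^ 2) := by
    ext w
    split_ifs with h
    · rw [h]; ring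
    · ring
  simp only at h1 ⊢
  rw [h1, hnuis.integral_armIndicator_mul (g := fun x => σ2 d x * (armProp p d x)⁻¹ ^ 2)
    (hερ.mono fun w hw => hε.le.trans hw) hρ1
    ((hnuis.measurable_variance d).mul (hρ.inv.pow_const 2))]
  refine integral_congr_ae ?_
  filter_upwards [hερ] with w hw
  have : armProp p d (cov w) ≠ 0 := (hε.trans_le hw).ne'
  field_simp

/-- The covariance vanishes since the cross term is again the residual times a function of the arm
and the covariates, integrable as a product of two `L²` functions. The square of `signedWeight` has
no mixed term because the arms are disjoint, and integrating out the arm turns `σ2 / ρ ^ 2` into `σ2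
/ ρ`. -/
lemma variance_score (hnuis : IsNuisance Q μ σ2 p) (hε : 0 < ε)
    (hov : ∀ᵐ w ∂Q, ε ≤ p (cov w) ∧ p (cov w) ≤ 1 - ε) (hY : Integrable outcome Q)
    (hres : MemLp (residual μ) 2 Q) (heff : MemLp (fun w => μ 1 (cov w) - μ 0 (cov w)) 2 Q) :
    Var[score μ p; Q] = asympVar Q μ σ2 p := by
  have hL2 := memLp_residual_mul_signedWeight hε hnuis.measurable_mean
    hnuis.measurable_propensity hov hres
  have h0 := hnuis.integral_residual_mul_signedWeight hε hov hY hres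
  have hwm := measurable_signedWeight hnuis.measurable_propensity
  have hcross : ∫ w, ((fun w => μ 1 (cov w) - μ 0 (cov w)) *
      fun w => residual μ w * signedWeight p (arm w, cov w)) w ∂Q = 0 := by
    have heq : ((fun w => μ 1 (cov w) - μ 0 (cov w)) *
          fun w => residual μ w * signedWeight p (arm w, cov w))
        = fun w => residual μ w *
          ((μ 1 (cov w) - μ 0 (cov w)) * signedWeight p (arm w, cov w)) := by
      ext w; simp only [Pi.mul_apply]; ring
    have hint := heff.integrable_mul hL2
    rw [heq] at hint ⊢
    exact hnuis.integral_residual_mul hY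
      (G := fun z => (μ 1 z.2 - μ 0 z.2) * signedWeight p z)
      ((((hnuis.measurable_mean 1).comp measurable_snd).sub
        ((hnuis.measurable_mean 0).comp measurable_snd)).mul hwm) hint
  have hcov : cov[fun w => μ 1 (CalDML.cov w) - μ 0 (CalDML.cov w),
      fun w => residual μ w * signedWeight p (arm w, CalDML.cov w); Q] = 0 := by
    rw [covariance_eq_sub heff hL2, hcross, h0]
    simp
  obtain ⟨hi1, he1⟩ := hnuis.integral_residual_sq_mul_armIndicator hε hov hres 1
  obtain ⟨hi0, he0⟩ := hnuis.integral_residual_sq_mul_armIndicator hε hov hres 0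
  have hsq : ∫ w, (residual μ w * signedWeight p (arm w, cov w)) ^ 2 ∂Q
      = ∫ w, σ2 1 (cov w) / p (cov w) ∂Q + ∫ w, σ2 0 (cov w) / (1 - p (cov w)) ∂Q := by
    simp_rw [mul_pow, signedWeight_sq, mul_add]
    rw [integral_add hi1 hi0, he1, he0]
    simp [armProp]
  rw [score_eq_add_residual_mul, variance_add heff hL2, hcov,
    variance_of_integral_eq_zero hL2.aemeasurable h0, hsq, asympVar]
  ring

end IsNuisance

end Score

/-! ### Uniform negligibility of the score error over shrinking nuisance classes. -/

section Uniform

lemma measure_le_abs_le_of_eLpNorm_le {Ω : Type*} [MeasurableSpace Ω] {P : Measure Ω} {X : Ω → ℝ}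
    (hX : Measurable X) {η δ : ℝ} (hη : 0 < η)
    (h : eLpNorm X 1 P ≤ ENNReal.ofReal (η * δ)) : P {ω | η ≤ |X ω|} ≤ ENNReal.ofReal δ := by
  have h1 : {ω | η ≤ |X ω|} = {ω | ENNReal.ofReal η ≤ ‖X ω‖ₑ} := by
    ext ω
    rw [Set.mem_ofPred_eq, Set.mem_ofPred_eq, ← ofReal_norm, Real.norm_eq_abs,
      ENNReal.ofReal_le_ofReal_iff (abs_nonneg _)]
  rw [h1]
  refine (meas_ge_le_lintegral_div hX.enorm.aemeasurable (by simpa using hη)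
    ENNReal.ofReal_ne_top).trans ?_
  rw [← eLpNorm_one_eq_lintegral_enorm]
  refine ENNReal.div_le_of_le_mul (h.trans_eq ?_)
  rw [mul_comm η, ENNReal.ofReal_mul' hη.le]

variable {𝓧 : Type*} [MeasurableSpace 𝓧]

lemma measurable_score_uncurry {β : Type*} [MeasurableSpace β] {m : Fin 2 → β → 𝓧 → ℝ}
    (hm : ∀ d, Measurable (Function.uncurry (m d))) {π : β → 𝓧 → ℝ}
    (hπ : Measurable (Function.uncurry π)) :
    Measurable fun z : β × Obs 𝓧 => score (fun d => m d z.1) (π z.1) z.2 := by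
  have hbx : Measurable fun z : β × Obs 𝓧 => (z.1, cov z.2) :=
    measurable_fst.prodMk (measurable_cov.comp measurable_snd)
  have hmz : ∀ d, Measurable fun z : β × Obs 𝓧 => m d z.1 (cov z.2) := fun d => (hm d).comp hbx
  have hπz : Measurable fun z : β × Obs 𝓧 => π z.1 (cov z.2) := hπ.comp hbx
  have hYz : Measurable fun z : β × Obs 𝓧 => outcome z.2 := measurable_outcome.comp measurable_snd
  have hDz : Measurable fun z : β × Obs 𝓧 => treat z.2 := by
    simp_rw [treat_eq_ite]
    exact (measurable_armIndicator 1).comp measurable_snd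
  exact (((hmz 1).sub (hmz 0)).add ((hDz.mul (hYz.sub (hmz 1))).div hπz)).sub
    (((measurable_const.sub hDz).mul (hYz.sub (hmz 0))).div (measurable_const.sub hπz))

variable {Ω : Type*} [MeasurableSpace Ω] {P : Measure Ω} [IsProbabilityMeasure P]
  {Q : Measure (Obs 𝓧)} [IsProbabilityMeasure Q] {μ σ2 : Fin 2 → 𝓧 → ℝ} {p : 𝓧 → ℝ} {ε : ℝ}

/-- The normalized sum of the score is insensitive to estimated nuisances, uniformly over nuisances
whose `L²` errors `a` and `b` tend to zero and satisfy `a * b = o(N^{-1/2})`. -/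
lemma eventually_eLpNorm_normalizedSum_score_sub_le {ι : ℕ → Type*} [∀ N, Fintype (ι N)]
    (hcard : ∀ N, Fintype.card (ι N) ≤ N) {W : ∀ N, ι N → Ω → Obs 𝓧}
    (hW : ∀ N i, Measurable (W N i)) (hlaw : ∀ N i, P.map (W N i) = Q)
    (hindep : ∀ N, iIndepFun (W N) P) (hnuis : IsNuisance Q μ σ2 p)
    (hε : 0 < ε) (hov : ∀ᵐ w ∂Q, ε ≤ p (cov w) ∧ p (cov w) ≤ 1 - ε)
    (hY : Integrable outcome Q) (hres : MemLp (residual μ) 2 Q)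
    {a : Fin 2 → ℕ → ℝ≥0∞} {b : ℕ → ℝ≥0∞} (ha : ∀ d, Tendsto (a d) atTop (𝓝 0))
    (hb : Tendsto b atTop (𝓝 0))
    (hab : ∀ d, Tendsto (fun N : ℕ => ENNReal.ofReal √(N : ℝ) * (a d N * b N)) atTop (𝓝 0))
    {δ : ℝ} (hδ : 0 < δ) :
    ∀ᶠ N in atTop, ∀ (m : Fin 2 → 𝓧 → ℝ) (π : 𝓧 → ℝ), (∀ d, Measurable (m d)) →
      (∀ d, normX Q 2 (fun x => m d x - μ d x) ≤ a d N) → Measurable π →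
      (∀ᵐ w ∂Q, ε ≤ π (cov w) ∧ π (cov w) ≤ 1 - ε) →
      normX Q 2 (fun x => π x - p x) ≤ b N →
      eLpNorm (normalizedSum (W N) N Finset.univ (score m π - score μ p)) 1 P
        ≤ ENNReal.ofReal δ := by
  -- The level `T` is chosen before `N`, so the term `T * ε⁻¹ ^ 2 * b N` still vanishes. After
  -- multiplication by `ε⁻¹` the tail contributes `δ / 4`, strictly less than the budget `δ / 2` of
  -- one arm.
  obtain ⟨T, hT, htail⟩ := exists_residualTail_le hnuis.measurable_mean hres
    (by positivity : 0 < ε * (δ / 4))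
  have htail' : ENNReal.ofReal ε⁻¹ * residualTail Q μ T ≤ ENNReal.ofReal (δ / 4) := by
    refine (mul_le_mul_right htail _).trans_eq ?_
    rw [← ENNReal.ofReal_mul (by positivity), inv_mul_cancel_left₀ hε.ne']
  have harm : ∀ d, ∀ᶠ N : ℕ in atTop, ENNReal.ofReal ε⁻¹ * a d N
        + (ENNReal.ofReal (T * ε⁻¹ ^ 2) * b N + ENNReal.ofReal ε⁻¹ * residualTail Q μ T)
        + ENNReal.ofReal (ε⁻¹ ^ 2) * (ENNReal.ofReal √(N : ℝ) * (a d N * b N))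
      < ENNReal.ofReal (δ / 2) := fun d => by
    have h1 := ENNReal.Tendsto.const_mul (a := ENNReal.ofReal ε⁻¹) (ha d)
      (Or.inr ENNReal.ofReal_ne_top)
    have h2 := ENNReal.Tendsto.const_mul (a := ENNReal.ofReal (T * ε⁻¹ ^ 2)) hb
      (Or.inr ENNReal.ofReal_ne_top)
    have h3 := ENNReal.Tendsto.const_mul (a := ENNReal.ofReal (ε⁻¹ ^ 2)) (hab d)
      (Or.inr ENNReal.ofReal_ne_top)
    have h4 := (h1.add (h2.add_const (ENNReal.ofReal ε⁻¹ * residualTail Q μ T))).add h3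
    refine h4.eventually_lt_const ?_
    simp only [mul_zero, zero_add, add_zero]
    exact htail'.trans_lt ((ENNReal.ofReal_lt_ofReal_iff (by positivity)).2 (by linarith))
  filter_upwards [eventually_all.2 harm,
    eventually_all.2 fun d => (ha d).eventually_lt_const ENNReal.zero_lt_top]
    with N hN hfin m π hm hma hπ hπov hπb
  have key : ∀ d, eLpNorm (normalizedSum (W N) N Finset.univ
      (armScore d (m d) (armProp π d) - armScore d (μ d) (armProp p d))) 1 P
        ≤ ENNReal.ofReal (δ / 2) := fun d => by
    refine (eLpNorm_normalizedSum_armScore_sub_le (hW N) (hlaw N) (hindep N) hnuis hε hov hY hres d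
      (hm d) ((hma d).trans_lt (hfin d)) hπ hπov hT.le (hcard N)).trans ?_
    refine le_trans ?_ (hN d).le
    rw [mul_left_comm (ENNReal.ofReal √(N : ℝ))]
    gcongr
    · exact hma d
    · exact hma d
  have hmeas : ∀ d, Measurable
      (armScore d (m d) (armProp π d) - armScore d (μ d) (armProp p d)) := fun d =>
    (measurable_armScore d (hm d) (measurable_armProp hπ d)).sub
      (measurable_armScore d (hnuis.measurable_mean d)
        (measurable_armProp hnuis.measurable_propensity d))
  have hsplit : score m π - score μ p
      = (armScore 1 (m 1) (armProp π 1) - armScore 1 (μ 1) (armProp p 1))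
        - (armScore 0 (m 0) (armProp π 0) - armScore 0 (μ 0) (armProp p 0)) := by
    rw [score_eq_armScore_sub, score_eq_armScore_sub]
    abel
  rw [hsplit, normalizedSum_sub]
  calc _ ≤ _ := eLpNorm_sub_le (measurable_normalizedSum (hW N) (hmeas 1) _ _).aestronglyMeasurable
        (measurable_normalizedSum (hW N) (hmeas 0) _ _).aestronglyMeasurable le_rfl
    _ ≤ ENNReal.ofReal (δ / 2) + ENNReal.ofReal (δ / 2) := add_le_add (key 1) (key 0)
    _ = ENNReal.ofReal δ := by rw [← ENNReal.ofReal_add (by positivity) (by positivity), add_halves]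

end Uniform

/-! ### The inner layer of conditioning: a deterministic score function and a fitted calibrator. -/

section CrossFitting

variable {𝓧 Ω : Type*} [MeasurableSpace 𝓧] [MeasurableSpace Ω] {P : Measure Ω}
  {Q : Measure (Obs 𝓧)} {W : ℕ → Ω → Obs 𝓧} {μ σ2 : Fin 2 → 𝓧 → ℝ} {p : 𝓧 → ℝ} {K J : ℕ}
  {A : Procedure 𝓧 K J} {Ξμ : ℕ → Fin 2 → Set (𝓧 → ℝ)} {Ξp : ℕ → Set (𝓧 → ℝ)}
  {f : (𝓧 → ℝ) → ℝ → ℝ} {Λ : ℕ → (𝓧 → ℝ) → Set (ℝ → ℝ)} {ε w C : ℝ}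

/-- The observations of the sub-fold `c`. -/
def cellObs (A : Procedure 𝓧 K J) (W : ℕ → Ω → Obs 𝓧) (N : ℕ) (c : Fin K × Fin J)
    (i : {i : Fin N // A.fold N i = c}) : Ω → Obs 𝓧 := W (i : Fin N)

/-- The rate of the calibrated propensity score. -/
noncomputable def calibratedRate (Q : Measure (Obs 𝓧)) (p : 𝓧 → ℝ) (f : (𝓧 → ℝ) → ℝ → ℝ)
    (Ξ : Set (𝓧 → ℝ)) (Λ : (𝓧 → ℝ) → Set (ℝ → ℝ)) (C : ℝ) : ℝ≥0∞ :=
  calRate Q f Ξ Λ + ENNReal.ofReal C * supDist Q 2 Ξ p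

lemma normX_sub_le_supDist {s : ℝ≥0∞} {G : Set (𝓧 → ℝ)} {g g' : 𝓧 → ℝ} (h : g' ∈ G) :
    normX Q s (fun x => g' x - g x) ≤ supDist Q s G g :=
  le_iSup₂ (f := fun g' (_ : g' ∈ G) => normX Q s fun x => g' x - g x) g' h

/-- Triangle inequality through `f q ∘ q`: the calibrator is compared with the calibration function
of `q`, and that function with `p` by `error_bound`. -/
lemma CalibratorConditions.normX_comp_sub_le
    (hcal : CalibratorConditions P W Q μ p A Ξμ Ξp f Λ ε C) (hp : Measurable p) {N : ℕ}
    {q : 𝓧 → ℝ} (hq : q ∈ Ξp N) (hqm : Measurable q) {g : ℝ → ℝ} (hg : g ∈ Λ N q) :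
    normX Q 2 (fun x => g (q x) - p x) ≤ calibratedRate Q p f (Ξp N) (Λ N) C := by
  have hgm := hcal.measurable_realization N q hq g hg
  have hfm := hcal.measurable_calibration N q hq
  have hqc := hqm.comp (measurable_cov (𝓧 := 𝓧))
  have hsplit : (fun w : Obs 𝓧 => g (q (cov w)) - p (cov w))
      = (fun w => g (q (cov w)) - f q (q (cov w))) + fun w => f q (q (cov w)) - p (cov w) := by
    ext w; simp
  calc normX Q 2 (fun x => g (q x) - p x)
      ≤ normX Q 2 (fun x => g (q x) - f q (q x)) + normX Q 2 (fun x => f q (q x) - p x) := by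
        unfold normX
        rw [hsplit]
        exact eLpNorm_add_le ((hgm.comp hqc).sub (hfm.comp hqc)).aestronglyMeasurable
          ((hfm.comp hqc).sub (hp.comp measurable_cov)).aestronglyMeasurable (by norm_num)
    _ ≤ _ := by
        refine add_le_add ?_ (le_trans ?_ (hcal.error_bound N))
        · exact le_trans
            (le_iSup₂ (f := fun g (_ : g ∈ Λ N q) => normX Q 2 fun x => g (q x) - f q (q x)) g hg)
            (le_iSup₂ (f := fun q (_ : q ∈ Ξp N) =>
              ⨆ g ∈ Λ N q, normX Q 2 fun x => g (q x) - f q (q x)) q hq)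
        · exact le_iSup₂ (f := fun q (_ : q ∈ Ξp N) => normX Q 2 fun x => f q (q x) - p x) q hq

lemma tendsto_calibratedRate (hdml : DMLConditions P W Q μ p A Ξμ Ξp ε w)
    (hcal : CalibratorConditions P W Q μ p A Ξμ Ξp f Λ ε C) :
    Tendsto (fun N => calibratedRate Q p f (Ξp N) (Λ N) C) atTop (𝓝 0) := by
  simpa [calibratedRate] using hcal.rate.add
    (ENNReal.Tendsto.const_mul (a := ENNReal.ofReal C) hdml.rate_propensity
      (Or.inr ENNReal.ofReal_ne_top))

lemma tendsto_sqrt_mul_calibratedRate (hdml : DMLConditions P W Q μ p A Ξμ Ξp ε w)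
    (hcal : CalibratorConditions P W Q μ p A Ξμ Ξp f Λ ε C) (d : Fin 2) :
    Tendsto (fun N : ℕ => ENNReal.ofReal √(N : ℝ) *
      (supDist Q 2 (Ξμ N d) (μ d) * calibratedRate Q p f (Ξp N) (Λ N) C)) atTop (𝓝 0) := by
  have h := (hcal.rate_product d).add
    (ENNReal.Tendsto.const_mul (a := ENNReal.ofReal C) (hdml.rate_product d)
      (Or.inr ENNReal.ofReal_ne_top))
  simp only [mul_zero, add_zero] at h
  refine h.congr fun N => ?_
  unfold calibratedRate
  ring

variable [IsProbabilityMeasure P] [IsProbabilityMeasure Q]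

/-- Conditionally on the training sample, that is for fixed outcome regressions and a fixed score
function, the error of a sub-fold is small with high probability, uniformly over the realization
sets. -/
lemma eventually_measure_normalizedSum_calFit_le (hW : ∀ i, Measurable (W i))
    (hlaw : ∀ i, P.map (W i) = Q) (hindep : iIndepFun W P) (hnuis : IsNuisance Q μ σ2 p)
    (hA : A.IsMeasurable) (hε : 0 < ε) (hdml : DMLConditions P W Q μ p A Ξμ Ξp ε w)
    (hcal : CalibratorConditions P W Q μ p A Ξμ Ξp f Λ ε C) (k : Fin K) (j : Fin J)
    {η δ : ℝ} (hη : 0 < η) (hδ : 0 < δ) :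
    ∀ᶠ N in atTop, ∀ (m : Fin 2 → 𝓧 → ℝ) (q : 𝓧 → ℝ), (∀ d, m d ∈ Ξμ N d) → q ∈ Ξp N →
      P {ω | η ≤ |normalizedSum (cellObs A W N (k, j)) N Finset.univ
        (score m (fun x => A.calFit W N k j q ω (q x)) - score μ p) ω|} ≤ ENNReal.ofReal δ := by
  have hWc : ∀ N i, Measurable (cellObs A W N (k, j) i) := fun N i => hW _
  have hindepFin : ∀ N : ℕ, iIndepFun (fun i : Fin N => W i) P := fun N =>
    hindep.precomp Fin.val_injective
  obtain ⟨δN, hδN, hreal⟩ := hcal.realization k j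
  filter_upwards [eventually_eLpNorm_normalizedSum_score_sub_le (P := P) (Q := Q)
      (W := fun N => cellObs A W N (k, j))
      (fun N => (Fintype.card_subtype_le _).trans (Fintype.card_fin N).le) hWc
      (fun N i => hlaw _)
      (fun N => iIndepFun.precomp (g := Subtype.val) Subtype.val_injective (hindepFin N)) hnuis hε
      hdml.overlap hdml.integrable_outcome hdml.finite_residual_variance hdml.rate_mean
      (tendsto_calibratedRate hdml hcal) (tendsto_sqrt_mul_calibratedRate hdml hcal)
      -- An `L¹` bound `η * (δ / 2)` gives probability at most `δ / 2` by Markov's inequality; the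
      -- other half of `δ` pays for the calibrator leaving its realization set.
      (by positivity : 0 < η * (δ / 2)),
    hδN.eventually_lt_const (ENNReal.ofReal_pos.2 (half_pos hδ))] with N hN hδ2 m q hm hq
  have hmm : ∀ d, Measurable (m d) := fun d => hdml.measurable_mean N d _ (hm d)
  have hqm := hdml.measurable_propensity N q hq
  set T : Ω → {i : Fin N // (A.fold N i).1 = k ∧ (A.fold N i).2 ≠ j} → Obs 𝓧 :=
    fun ω i => W (i : Fin N) ω
  set U : Ω → {i : Fin N // A.fold N i = (k, j)} → Obs 𝓧 := fun ω i => W (i : Fin N) ω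
  have hTm : Measurable T := measurable_pi_lambda _ fun i => hW _
  have hUm : Measurable U := measurable_pi_lambda _ fun i => hW _
  have hTU : IndepFun T U P := indepFun_subtype (fun i : Fin N => hW i) (hindepFin N)
    fun i h1 h2 => h1.2 (by rw [h2])
  -- With `q` deterministic, the calibrated propensity is a function of `T` alone, so freezing `T`
  -- freezes it while the sub-fold `U` stays i.i.d.
  let cal : ({i : Fin N // (A.fold N i).1 = k ∧ (A.fold N i).2 ≠ j} → Obs 𝓧) → 𝓧 → ℝ :=
    fun t x => A.fTilde N k j (fun i => (q (cov (t i)), t i)) (q x)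
  have hcalm : Measurable (Function.uncurry cal) := by
    refine (hA.fTilde N k j).comp (Measurable.prodMk (measurable_pi_lambda _ fun i => ?_)
      (hqm.comp measurable_snd))
    have hti : Measurable fun z : ({i : Fin N // (A.fold N i).1 = k ∧ (A.fold N i).2 ≠ j} →
        Obs 𝓧) × 𝓧 => z.1 i := (measurable_pi_apply i).comp measurable_fst
    exact (hqm.comp (measurable_cov.comp hti)).prodMk hti
  let G := fun z : ({i : Fin N // (A.fold N i).1 = k ∧ (A.fold N i).2 ≠ j} → Obs 𝓧) ×
      ({i : Fin N // A.fold N i = (k, j)} → Obs 𝓧) =>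
    (√(N : ℝ))⁻¹ * ∑ i, (score m (cal z.1) - score μ p) (z.2 i)
  have hG : Measurable G := by
    refine (Finset.measurable_fun_sum _ fun i _ => ?_).const_mul _
    have hzi : Measurable fun z : ({i : Fin N // (A.fold N i).1 = k ∧ (A.fold N i).2 ≠ j} →
        Obs 𝓧) × ({i : Fin N // A.fold N i = (k, j)} → Obs 𝓧) => z.2 i :=
      (measurable_pi_apply i).comp measurable_snd
    exact ((measurable_score_uncurry (m := fun d _ => m d)
      (fun d => (hmm d).comp measurable_snd) hcalm).comp
      (measurable_fst.prodMk hzi)).sub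
      ((measurable_score hnuis.measurable_mean hnuis.measurable_propensity).comp hzi)
  have hmain := measure_mem_le_of_indepFun (P := P) hTm hUm hTU (E := {z | η ≤ |G z|})
    (measurableSet_le measurable_const hG.abs) (c := ENNReal.ofReal (δ / 2))
    (δ := ENNReal.ofReal (δ / 2)) ?_
  · refine hmain.trans_eq ?_
    rw [← ENNReal.ofReal_add (by positivity) (by positivity), add_halves]
  · have hov0 : P {ω | ¬ ∀ᵐ v ∂Q, ε ≤ A.calFit W N k j q ω (q (cov v)) ∧
        A.calFit W N k j q ω (q (cov v)) ≤ 1 - ε} = 0 := ae_iff.1 (hcal.overlap N k j q hq)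
    -- The conditional probability can exceed `δ / 2` only if the calibrator leaves its realization
    -- set or violates overlap; the second event is null.
    calc _ ≤ P ({ω | A.calFit W N k j q ω ∉ Λ N q} ∪
          {ω | ¬ ∀ᵐ v ∂Q, ε ≤ A.calFit W N k j q ω (q (cov v)) ∧
            A.calFit W N k j q ω (q (cov v)) ≤ 1 - ε}) := by
          refine measure_mono fun ω' hω' => ?_
          by_contra hgood
          simp only [Set.mem_union, Set.mem_ofPred_eq, not_or, not_not] at hgood
          refine hω' ?_
          have hπm : Measurable (cal (T ω')) :=
            hcalm.comp (measurable_const.prodMk measurable_id)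
          refine measure_le_abs_le_of_eLpNorm_le
            (X := normalizedSum (cellObs A W N (k, j)) N Finset.univ
              (score m (cal (T ω')) - score μ p))
            (measurable_normalizedSum (hWc N) ((measurable_score hmm hπm).sub
              (measurable_score hnuis.measurable_mean hnuis.measurable_propensity)) _ _) hη ?_
          exact hN m (cal (T ω')) hmm (fun d => normX_sub_le_supDist (hm d)) hπm hgood.2
            (hcal.normX_comp_sub_le hnuis.measurable_propensity hq hqm hgood.1)
      _ ≤ _ := measure_union_le _ _
      _ ≤ δN N + 0 := add_le_add (hreal N q hq) hov0.le
      _ ≤ ENNReal.ofReal (δ / 2) := by rw [add_zero]; exact hδ2.le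

end CrossFitting

/-! ### The outer layer of conditioning and the reduction to the oracle estimator. -/

section Estimator

variable {𝓧 Ω : Type*} {W : ℕ → Ω → Obs 𝓧} {μ σ2 : Fin 2 → 𝓧 → ℝ} {p : 𝓧 → ℝ} {K J : ℕ}
  {A : Procedure 𝓧 K J}

/-- The contribution of the sub-fold `c` to the difference between the normalized estimator and
the normalized oracle estimator. -/
noncomputable def cellError (A : Procedure 𝓧 K J) (W : ℕ → Ω → Obs 𝓧) (μ : Fin 2 → 𝓧 → ℝ)
    (p : 𝓧 → ℝ) (N : ℕ) (c : Fin K × Fin J) (ω : Ω) : ℝ :=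
  normalizedSum (cellObs A W N c) N Finset.univ
    (score (A.muFit W N c.1 ω) (A.piFit W N c.1 c.2 ω) - score μ p) ω

/-- The fitted regressions and the calibrated propensity are common to all observations of a
sub-fold, so the sum is regrouped along the fibers of `A.fold N`. -/
lemma sqrt_mul_thetaHat_sub (N : ℕ) (θ : ℝ) (ω : Ω) :
    √(N : ℝ) * (A.thetaHat W N ω - θ)
      = (√(N : ℝ))⁻¹ * (∑ i ∈ Finset.range N, score μ p (W i ω) - N * θ)
        + ∑ c, cellError A W μ p N c ω := by
  have hsum : ∑ c, cellError A W μ p N c ω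
      = (√(N : ℝ))⁻¹ * (∑ i : Fin N, score (A.muFit W N (A.fold N i).1 ω)
          (A.piFit W N (A.fold N i).1 (A.fold N i).2 ω) (W i ω)
        - ∑ i ∈ Finset.range N, score μ p (W i ω)) := by
    rw [Finset.sum_range, ← Finset.sum_sub_distrib, ← Fintype.sum_fiberwise (A.fold N),
      Finset.mul_sum]
    refine Finset.sum_congr rfl fun c _ => ?_
    rw [cellError, normalizedSum]
    congr 1
    refine Finset.sum_congr rfl fun i _ => ?_
    rw [i.2]
    rfl
  rw [hsum, Procedure.thetaHat]
  rcases Nat.eq_zero_or_pos N with rfl | hN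
  · simp
  · have h0 : (0 : ℝ) < √(N : ℝ) := by positivity
    field_simp
    rw [Real.sq_sqrt (by positivity)]
    ring

variable [MeasurableSpace 𝓧] [MeasurableSpace Ω] {P : Measure Ω} {Q : Measure (Obs 𝓧)}
  {Ξμ : ℕ → Fin 2 → Set (𝓧 → ℝ)} {Ξp : ℕ → Set (𝓧 → ℝ)}
  {f : (𝓧 → ℝ) → ℝ → ℝ} {Λ : ℕ → (𝓧 → ℝ) → Set (ℝ → ℝ)} {ε w C : ℝ}

lemma measurable_uncurry_calibrated {β γ : Type*} [MeasurableSpace β] [MeasurableSpace γ]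
    {ι : Type*} {F : (ι → ℝ × Obs 𝓧) → ℝ → ℝ} (hF : Measurable (Function.uncurry F))
    {q : β → 𝓧 → ℝ} (hq : Measurable (Function.uncurry q)) {g : γ → β} (hg : Measurable g)
    {v : γ → ι → Obs 𝓧} (hv : Measurable v) :
    Measurable (Function.uncurry fun (c : γ) (x : 𝓧) =>
      F (fun i => (q (g c) (cov (v c i)), v c i)) (q (g c) x)) := by
  have hgc : Measurable fun z : γ × 𝓧 => g z.1 := hg.comp measurable_fst
  refine hF.comp (Measurable.prodMk (measurable_pi_lambda _ fun i => ?_)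
    (hq.comp (hgc.prodMk measurable_snd)))
  have hvi : Measurable fun z : γ × 𝓧 => v z.1 i :=
    (measurable_pi_apply i).comp (hv.comp measurable_fst)
  exact (hq.comp (hgc.prodMk (measurable_cov.comp hvi))).prodMk hvi

lemma measurable_thetaHat (hW : ∀ i, Measurable (W i)) (hA : A.IsMeasurable) (N : ℕ) :
    Measurable (A.thetaHat W N) := by
  refine (Finset.measurable_fun_sum _ fun i _ => ?_).const_mul _
  have htr : Measurable (A.train W N (A.fold N i).1) := measurable_pi_lambda _ fun i => hW _
  have hπ := measurable_uncurry_calibrated (hA.fTilde N (A.fold N i).1 (A.fold N i).2)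
    (hA.pHat N (A.fold N i).1) htr
    (v := fun ω (i' : {i' : Fin N // (A.fold N i').1 = (A.fold N i).1 ∧
      (A.fold N i').2 ≠ (A.fold N i).2}) => W (i' : Fin N) ω)
    (measurable_pi_lambda _ fun i => hW _)
  exact (measurable_score_uncurry
    (m := fun d ω => A.muHat N (A.fold N i).1 d (A.train W N (A.fold N i).1 ω))
    (fun d => (hA.muHat N (A.fold N i).1 d).comp
      ((htr.comp measurable_fst).prodMk measurable_snd)) hπ).comp
    (measurable_id.prodMk (hW i))

variable [IsProbabilityMeasure P] [IsProbabilityMeasure Q]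

/-- Conditioning on the training sample turns the fitted regressions and score into deterministic
members of the realization sets, to which the uniform bound of the inner layer applies. -/
lemma eventually_measure_cellError_le (hW : ∀ i, Measurable (W i))
    (hlaw : ∀ i, P.map (W i) = Q) (hindep : iIndepFun W P) (hnuis : IsNuisance Q μ σ2 p)
    (hA : A.IsMeasurable) (hε : 0 < ε) (hdml : DMLConditions P W Q μ p A Ξμ Ξp ε w)
    (hcal : CalibratorConditions P W Q μ p A Ξμ Ξp f Λ ε C) (c : Fin K × Fin J)
    {η δ : ℝ} (hη : 0 < η) (hδ : 0 < δ) :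
    ∀ᶠ N in atTop, P {ω | η ≤ |cellError A W μ p N c ω|} ≤ ENNReal.ofReal δ := by
  obtain ⟨k, j⟩ := c
  have hδ2 : 0 < δ / 2 := half_pos hδ
  filter_upwards [eventually_measure_normalizedSum_calFit_le hW hlaw hindep hnuis hA hε hdml hcal
      k j hη hδ2,
    (hdml.realization k).eventually_lt_const (ENNReal.ofReal_pos.2 hδ2)] with N hN hreal
  -- The whole fold is kept random here: it contains both the calibration sample and the sub-fold of
  -- evaluation.
  set U : Ω → {i : Fin N // (A.fold N i).1 = k} → Obs 𝓧 := fun ω i => W (i : Fin N) ω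
  have hTm : Measurable (A.train W N k) := measurable_pi_lambda _ fun i => hW _
  have hUm : Measurable U := measurable_pi_lambda _ fun i => hW _
  have hTU : IndepFun (A.train W N k) U P := indepFun_subtype (fun i : Fin N => hW i)
    (hindep.precomp Fin.val_injective) fun i h1 h2 => h1 h2
  let Γ := ({i : Fin N // (A.fold N i).1 ≠ k} → Obs 𝓧) × ({i : Fin N // (A.fold N i).1 = k} → Obs 𝓧)
  let cal : Γ → 𝓧 → ℝ := fun z x => A.fTilde N k j
    (fun i => (A.pHat N k z.1 (cov (z.2 ⟨i, i.2.1⟩)), z.2 ⟨i, i.2.1⟩)) (A.pHat N k z.1 x)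
  have hcalm : Measurable (Function.uncurry cal) :=
    measurable_uncurry_calibrated (hA.fTilde N k j) (hA.pHat N k) (γ := Γ) measurable_fst
      (v := fun z (i : {i : Fin N // (A.fold N i).1 = k ∧ (A.fold N i).2 ≠ j}) =>
        z.2 ⟨i, i.2.1⟩)
      (measurable_pi_lambda _ fun i => (measurable_pi_apply _).comp measurable_snd)
  let G : Γ → ℝ := fun z => (√(N : ℝ))⁻¹ * ∑ i : {i : Fin N // A.fold N i = (k, j)},
    (score (fun d => A.muHat N k d z.1) (cal z) - score μ p)
      (z.2 ⟨i, congrArg Prod.fst i.2⟩)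
  have hG : Measurable G := by
    refine (Finset.measurable_fun_sum _ fun i _ => ?_).const_mul _
    have hzi : Measurable fun z : Γ => z.2 ⟨i, congrArg Prod.fst i.2⟩ :=
      (measurable_pi_apply _).comp measurable_snd
    exact ((measurable_score_uncurry (m := fun d (z : Γ) => A.muHat N k d z.1)
      (fun d => (hA.muHat N k d).comp
        ((measurable_fst.comp measurable_fst).prodMk measurable_snd)) hcalm).comp
      (measurable_id.prodMk hzi)).sub
      ((measurable_score hnuis.measurable_mean hnuis.measurable_propensity).comp hzi)
  have hmain := measure_mem_le_of_indepFun (P := P) hTm hUm hTU (E := {z | η ≤ |G z|})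
    (measurableSet_le measurable_const hG.abs) (c := ENNReal.ofReal (δ / 2))
    (δ := ENNReal.ofReal (δ / 2)) ?_
  · refine hmain.trans_eq ?_
    rw [← ENNReal.ofReal_add hδ2.le hδ2.le, add_halves]
  · refine le_trans (measure_mono ?_) hreal.le
    intro ω' hω' hgood
    refine hω' ?_
    -- The section of `G` at the frozen training sample is by definition the normalized sum of the
    -- inner layer with `m = A.muFit W N k ω'` and `q = A.pFit W N k ω'`.
    exact hN (A.muFit W N k ω') (A.pFit W N k ω') hgood.1 hgood.2

lemma tendstoInMeasure_sum_cellError (hW : ∀ i, Measurable (W i))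
    (hlaw : ∀ i, P.map (W i) = Q) (hindep : iIndepFun W P) (hnuis : IsNuisance Q μ σ2 p)
    (hA : A.IsMeasurable) (hε : 0 < ε) (hdml : DMLConditions P W Q μ p A Ξμ Ξp ε w)
    (hcal : CalibratorConditions P W Q μ p A Ξμ Ξp f Λ ε C) :
    TendstoInMeasure P (fun N ω => ∑ c, cellError A W μ p N c ω) atTop 0 := by
  rw [tendstoInMeasure_iff_norm]
  intro η hη
  -- The added one makes `M` positive even when there are no cells, and makes the sum of the
  -- thresholds `η / M` strictly smaller than `η`.
  set M : ℝ := Fintype.card (Fin K × Fin J) + 1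
  have hM0 : 0 < M := by positivity
  have hcell : ∀ c, Tendsto (fun N => P {ω | η / M ≤ |cellError A W μ p N c ω|}) atTop (𝓝 0) := by
    intro c
    refine ENNReal.tendsto_nhds_zero.2 fun δ hδ => ?_
    obtain ⟨r, hr0, hrδ⟩ := ENNReal.lt_iff_exists_real_btwn.1 hδ
    filter_upwards [eventually_measure_cellError_le hW hlaw hindep hnuis hA hε hdml hcal c
      (div_pos hη hM0) (ENNReal.ofReal_pos.1 hrδ.1)] with N hN using hN.trans hrδ.2.le
  have hsum := tendsto_finsetSum Finset.univ fun c _ => hcell c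
  simp only [Finset.sum_const_zero] at hsum
  refine tendsto_of_tendsto_of_tendsto_of_le_of_le tendsto_const_nhds hsum
    (fun _ => zero_le) fun N => ?_
  refine (measure_mono fun ω hω => ?_).trans (measure_biUnion_finset_le Finset.univ _)
  by_contra hcon
  simp only [Set.mem_iUnion, Finset.mem_univ, Set.mem_ofPred_eq, exists_prop, true_and, not_exists,
    not_le] at hcon
  have h1 : ‖∑ c, cellError A W μ p N c ω‖ ≤ ∑ _c : Fin K × Fin J, η / M :=
    (norm_sum_le _ _).trans (Finset.sum_le_sum fun c _ => (hcon c).le)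
  have h2 : ∑ _c : Fin K × Fin J, η / M < η := by
    rw [Finset.sum_const, Finset.card_univ, nsmul_eq_mul, mul_div_assoc', div_lt_iff₀ hM0, mul_comm]
    gcongr
    linarith
  simp only [Pi.zero_apply, sub_zero, Set.mem_ofPred_eq] at hω
  linarith

end Estimator

end CalDML

/-! ### Central limit theorem for the oracle and transfer to the estimator. -/

theorem theorem1 {𝓧 Ω : Type*} [MeasurableSpace 𝓧] [MeasurableSpace Ω]
    (P : Measure Ω) [IsProbabilityMeasure P]
    (Q : Measure (CalDML.Obs 𝓧)) [IsProbabilityMeasure Q]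
    (W : ℕ → Ω → CalDML.Obs 𝓧)
    (hW : ∀ i, Measurable (W i)) (hlaw : ∀ i, P.map (W i) = Q) (hindep : iIndepFun W P)
    (μ σ2 : Fin 2 → 𝓧 → ℝ) (p : 𝓧 → ℝ) (hnuis : CalDML.IsNuisance Q μ σ2 p)
    (K J : ℕ) (A : CalDML.Procedure 𝓧 K J) (hA : A.IsMeasurable)
    (Ξμ : ℕ → Fin 2 → Set (𝓧 → ℝ)) (Ξp : ℕ → Set (𝓧 → ℝ))
    (f : (𝓧 → ℝ) → ℝ → ℝ) (Λ : ℕ → (𝓧 → ℝ) → Set (ℝ → ℝ))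
    (ε w C : ℝ) (hε : 0 < ε) (hw : 2 < w) (hC : 0 < C)
    (hdml : CalDML.DMLConditions P W Q μ p A Ξμ Ξp ε w)
    (hcal : CalDML.CalibratorConditions P W Q μ p A Ξμ Ξp f Λ ε C) :
    0 ≤ CalDML.asympVar Q μ σ2 p ∧
    TendstoInDistribution
      (fun (N : ℕ) ω => √(N : ℝ) * (A.thetaHat W N ω - CalDML.target Q μ)) atTop
      (id : ℝ → ℝ) (fun _ => P)
      (gaussianReal 0 (CalDML.asympVar Q μ σ2 p).toNNReal) := by
  have hY := hdml.integrable_outcome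
  have hres : MemLp (CalDML.residual μ) 2 Q := hdml.finite_residual_variance
  have heff := hdml.finite_effect_variance
  have hvar := hnuis.variance_score hε hdml.overlap hY hres heff
  have hmean := hnuis.integral_score hε hdml.overlap hY hres heff
  -- Nonnegativity ensures that `toNNReal` does not truncate the variance of the limit.
  refine ⟨hvar ▸ variance_nonneg _ _, ?_⟩
  have hsm := CalDML.measurable_score hnuis.measurable_mean hnuis.measurable_propensity
  have hmp : MeasurePreserving (W 0) P Q := ⟨hW 0, hlaw 0⟩
  have hL2 : MemLp (fun ω => CalDML.score μ p (W 0 ω)) 2 P :=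
    (CalDML.memLp_score hε hnuis.measurable_mean hnuis.measurable_propensity hdml.overlap hres
      heff).comp_measurePreserving hmp
  have hmean0 : ∫ ω, CalDML.score μ p (W 0 ω) ∂P = CalDML.target Q μ := by
    rw [← hmean, ← hlaw 0, integral_map (hW 0).aemeasurable hsm.aestronglyMeasurable]
  have hvar0 : Var[fun ω => CalDML.score μ p (W 0 ω); P] = CalDML.asympVar Q μ σ2 p := by
    rw [← hvar]
    exact hmp.variance_fun_comp hsm.aemeasurable
  have hclt := tendstoInDistribution_inv_sqrt_mul_sum_sub (P := P)
    (P' := gaussianReal 0 (CalDML.asympVar Q μ σ2 p).toNNReal) (Y := (id : ℝ → ℝ))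
    (X := fun i ω => CalDML.score μ p (W i ω))
    ⟨aemeasurable_id, by rw [Measure.map_id, hvar0]⟩ hL2 (hindep.comp _ fun _ => hsm)
    fun i => IdentDistrib.comp ⟨(hW i).aemeasurable, (hW 0).aemeasurable,
      (hlaw i).trans (hlaw 0).symm⟩ hsm
  -- Slutsky's argument: the limit law is unchanged by a difference tending to zero in probability,
  -- and that difference is the sum of the cell errors.
  refine tendstoInDistribution_of_tendstoInMeasure_sub _ _ hclt ?_ fun N =>
    (((CalDML.measurable_thetaHat hW hA N).sub measurable_const).const_mul _).aemeasurable
  convert! CalDML.tendstoInMeasure_sum_cellError hW hlaw hindep hnuis hA hε hdml hcal using 1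
  ext N ω
  simp only [Pi.sub_apply]
  rw [CalDML.sqrt_mul_thetaHat_sub (μ := μ) (p := p), hmean0]
  ring
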